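/- Let $N_y,N_d\ge 0$ be integers, let $\mathcal T$ be a finite set (the known set of time instants assigned to a given submodel), let $\sigma_e,\sigma_w>0$, and let $\Theta\in\mathbb R^{N_y\times N_d}$ and $d_t\in\mathbb R^{N_d}$ ($t\in\mathcal T$) be unknown deterministic parameters. The observations are $$x_t=d_t+e_t,\qquad y_t=\Theta d_t+w_t=\mathcal H(d_t)\theta+w_t ,\qquad t\in\mathcal T,$$ where $e_t\sim\mathcal N(0,\sigma_e^2I)$ i.i.d., $w_t\sim\mathcal N(0,\sigma_w^2I)$ i.i.d., the two sequences are independent, $\theta=\mathrm{vec}(\Theta^{\mathsf T})=[\theta_1^{\mathsf T},\dots,\theta_{N_y}^{\mathsf T}]^{\mathsf T}$ (so $\theta_j^{\mathsf T}$ is the $j$-th row of $\Theta$), $D=[d_t]_{t\in\mathcal T}$, $d=\mathrm{vec}(D)$ and $\mathcal H(d)=I\otimes d^{\mathsf T}\in\mathbb R^{N_y\times N_yN_d}$. Put $\Sigma_\Theta=\Theta(\sigma_w^2I+\sigma_e^2\Theta^{\mathsf T}\Theta)^{-1}\Theta^{\mathsf T}$. **(Fisher information.)** The observations have the joint Gaussian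 density as likelihood, the log-likelihood is differentiable in the parameters with square-integrable score, and the Fisher information matrix $F$ of $(\theta,d)$ (the second moment matrix of the score) is symmetric with blocks $$F_\theta=\tfrac1{\sigma_w^2}\sum_t\mathcal H(d_t)^{\mathsf T}\mathcal H(d_t)=\tfrac1{\sigma_w^2}\,I\otimes DD^{\mathsf T},\qquad F_{d_t}=\tfrac1{\sigma_e^2}I+\tfrac1{\sigma_w^2}\Theta^{\mathsf T}\Theta,\qquad F_{d_s,d_t}=0\ (s\ne t),$$ $$F_{\theta,d_t}^{\mathsf T}=\tfrac1{\sigma_w^2}\Theta^{\mathsf T}\mathcal H(d_t)=\tfrac1{\sigma_w^2}[\theta_1d_t^{\mathsf T},\dots,\theta_{N_y}d_t^{\mathsf T}].$$ **(Bounds.)** Suppose that $DD^{\mathsf T}$ is invertible. Then $F$ is positive definite and, with $\ge$ the Loewner order, the following hold. (a) The matrix $I\otimes DD^{\mathsf T}-\sigma_e^2\sum_t\mathcal H(d_t)^{\mathsf T}\Sigma_\Theta\mathcal H(d_t)$ is positive definite, and the $\theta$-block of $F^{-1}$ equals $$B_\theta=\sigma_w^2\Big(I\otimes DD^{\mathsf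 T}-\sigma_e^2\sum_t\mathcal H(d_t)^{\mathsf T}\Sigma_\Theta\mathcal H(d_t)\Big)^{-1}.$$ Every finite-variance estimator $\hat\theta$ of $\theta$ that is locally unbiased at the true parameter satisfies $\mathrm{Cov}(\hat\theta)\ge B_\theta$. (b) For each $i\in\mathcal T$ let $$C_i=\sigma_w^2\Big(I\otimes DD^{\mathsf T}-\sigma_e^2\sum_{t\ne i}\mathcal H(d_t)^{\mathsf T}\Sigma_\Theta\mathcal H(d_t)\Big)^{-1}.$$ The matrix inverted here is positive definite, and $C_i$ is the $\theta$-block of the inverse of the matrix obtained from $F$ by deleting the rows and columns of $d_i$. If moreover $\sum_{t\ne i}d_td_t^{\mathsf T}$ is invertible and $\tilde C_i$ is the expression $B_\theta$ formed from the samples $t\ne i$ only, then $C_i^{-1}=\tilde C_i^{-1}+\sigma_w^{-2}\mathcal H(d_i)^{\mathsf T}\mathcal H(d_i)$. The matrix inverted in $$B_{d_i}=\sigma_e^2\Big(I+\tfrac{\sigma_e^2}{\sigma_w^2}\Theta^{\mathsf T}\Theta-\tfrac{\sigma_e^2}{\sigma_w^4}\Theta^{\mathsf T}\mathcal H(d_i)C_i\mathcal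 H(d_i)^{\mathsf T}\Theta\Big)^{-1}$$ is positive definite, and $B_{d_i}$ is the $d_i$-block of $F^{-1}$. Every finite-variance estimator $\hat d_i$ of $d_i$ that is locally unbiased at the true parameter satisfies $\mathrm{Cov}(\hat d_i)\ge B_{d_i}$. Here an estimator is *locally unbiased* at the true parameter if its bias, as a function of $(\theta,d)$, vanishes there and is differentiable there with zero derivative; this holds in particular for every finite-variance estimator that is unbiased for all parameters near the true one. -/

import Mathlib

open MeasureTheory ProbabilityTheory Matrix
open scoped Kronecker

noncomputable section

namespace CCRB

/-- Index set of the unknown deterministic parameters: the entries `(j, k)` of `Θ`, followed by the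
entries `(t, k)` (sample `t`, coordinate `k`) of the input vectors. -/
abbrev ParamIdx (Ny Nd : ℕ) (ι : Type*) := (Fin Ny × Fin Nd) ⊕ (ι × Fin Nd)

/-- The observations `z_t = (x_t, y_t)` for all samples `t`. -/
abbrev Obs (Ny Nd : ℕ) (ι : Type*) := ι → (Fin Nd → ℝ) × (Fin Ny → ℝ)

section Model

variable {Ny Nd : ℕ} {ι : Type*}

/-- The parameter vector `(vec Θᵀ, vec D)`, where `D` has the columns `d_t`. -/
def param (Θ : Matrix (Fin Ny) (Fin Nd) ℝ) (D : Matrix (Fin Nd) ι ℝ) : ParamIdx Ny Nd ι → ℝ :=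
  Sum.elim (vec Θᵀ) (vec D)

/-- The matrix `Θ` read off from a parameter vector. -/
def thetaOf (p : ParamIdx Ny Nd ι → ℝ) : Matrix (Fin Ny) (Fin Nd) ℝ :=
  Matrix.of fun j k => p (Sum.inl (j, k))

/-- The input vector `d_t` read off from a parameter vector. -/
def inputOf (p : ParamIdx Ny Nd ι → ℝ) (t : ι) : Fin Nd → ℝ := fun k => p (Sum.inr (t, k))

theorem thetaOf_param (Θ : Matrix (Fin Ny) (Fin Nd) ℝ) (D : Matrix (Fin Nd) ι ℝ) :
    thetaOf (param Θ D) = Θ := rfl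

theorem inputOf_param (Θ : Matrix (Fin Ny) (Fin Nd) ℝ) (D : Matrix (Fin Nd) ι ℝ) (t : ι) :
    inputOf (param Θ D) t = D.col t := rfl

/-- The Gaussian law `N(0, σ² I)` on `ℝⁿ`. -/
def gaussianNoise (n : ℕ) (σ : ℝ) : Measure (Fin n → ℝ) :=
  Measure.pi fun _ => gaussianReal 0 (σ ^ 2).toNNReal

variable [Fintype ι]

/-- The law of the observations `x_t = d_t + e_t`, `y_t = Θ d_t + w_t`, where the `e_t` are i.i.d.
`N(0, σe² I)`, the `w_t` are i.i.d. `N(0, σw² I)`, and the two sequences are independent. -/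
def obsLaw (σe σw : ℝ) (p : ParamIdx Ny Nd ι → ℝ) : Measure (Obs Ny Nd ι) :=
  (Measure.pi fun _ : ι => (gaussianNoise Nd σe).prod (gaussianNoise Ny σw)).map
    fun n t => (inputOf p t + (n t).1, thetaOf p *ᵥ inputOf p t + (n t).2)

/-- The likelihood function (joint Gaussian density of the observations). -/
def likelihood (σe σw : ℝ) (p : ParamIdx Ny Nd ι → ℝ) (z : Obs Ny Nd ι) : ℝ :=
  ∏ t, (∏ k, gaussianPDFReal (inputOf p t k) (σe ^ 2).toNNReal ((z t).1 k)) *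
    ∏ j, gaussianPDFReal ((thetaOf p *ᵥ inputOf p t) j) (σw ^ 2).toNNReal ((z t).2 j)

variable [DecidableEq ι]

/-- The component `a` of the score: the partial derivative of the log-likelihood with respect to
the parameter `a`. -/
def score (σe σw : ℝ) (p : ParamIdx Ny Nd ι → ℝ) (a : ParamIdx Ny Nd ι) (z : Obs Ny Nd ι) : ℝ :=
  fderiv ℝ (fun q => Real.log (likelihood σe σw q z)) p (Pi.single a 1)

/-- The Fisher information matrix: the second moment matrix of the score. -/
def fisherInfo (σe σw : ℝ) (p : ParamIdx Ny Nd ι → ℝ) :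
    Matrix (ParamIdx Ny Nd ι) (ParamIdx Ny Nd ι) ℝ :=
  Matrix.of fun a b => ∫ z, score σe σw p a z * score σe σw p b z ∂(obsLaw σe σw p)

end Model

section Blocks

variable {Ny Nd : ℕ} {ι : Type*}

/-- The block of a matrix in rows and columns `θ`. -/
def thetaBlock (F : Matrix (ParamIdx Ny Nd ι) (ParamIdx Ny Nd ι) ℝ) :
    Matrix (Fin Ny × Fin Nd) (Fin Ny × Fin Nd) ℝ :=
  F.submatrix Sum.inl Sum.inl

/-- The block of a matrix in rows `θ` and columns `d_t`. -/
def crossBlock (F : Matrix (ParamIdx Ny Nd ι) (ParamIdx Ny Nd ι) ℝ) (t : ι) :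
    Matrix (Fin Ny × Fin Nd) (Fin Nd) ℝ :=
  F.submatrix Sum.inl fun k => Sum.inr (t, k)

/-- The block of a matrix in rows `d_s` and columns `d_t`. -/
def inputBlock (F : Matrix (ParamIdx Ny Nd ι) (ParamIdx Ny Nd ι) ℝ) (s t : ι) :
    Matrix (Fin Nd) (Fin Nd) ℝ :=
  F.submatrix (fun k => Sum.inr (s, k)) fun k => Sum.inr (t, k)

/-- A matrix indexed by all parameters with the rows and columns of `d_i` deleted. -/
def deleteInput (F : Matrix (ParamIdx Ny Nd ι) (ParamIdx Ny Nd ι) ℝ) (i : ι) :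
    Matrix (ParamIdx Ny Nd {t // t ≠ i}) (ParamIdx Ny Nd {t // t ≠ i}) ℝ :=
  F.submatrix (Sum.map id (Prod.map Subtype.val id)) (Sum.map id (Prod.map Subtype.val id))

end Blocks

section Bounds

variable {Ny Nd : ℕ} {ι : Type*}

/-- `H(d) = I ⊗ dᵀ`, an `Ny × (Ny Nd)` matrix. -/
def regressor (Ny : ℕ) {Nd : ℕ} (d : Fin Nd → ℝ) : Matrix (Fin Ny) (Fin Ny × Fin Nd) ℝ :=
  ((1 : Matrix (Fin Ny) (Fin Ny) ℝ) ⊗ₖ replicateRow Unit d).submatrix (fun j => (j, ())) id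

/-- `Σ_Θ = Θ (σw² I + σe² Θᵀ Θ)⁻¹ Θᵀ`. -/
def sigmaTheta (σe σw : ℝ) (Θ : Matrix (Fin Ny) (Fin Nd) ℝ) : Matrix (Fin Ny) (Fin Ny) ℝ :=
  Θ * (σw ^ 2 • (1 : Matrix (Fin Nd) (Fin Nd) ℝ) + σe ^ 2 • (Θᵀ * Θ))⁻¹ * Θᵀ

/-- `I ⊗ D Dᵀ - σe² ∑_{t ∈ S} H(d_t)ᵀ Σ_Θ H(d_t)`. -/
def schurTheta [Fintype ι] (σe σw : ℝ) (Θ : Matrix (Fin Ny) (Fin Nd) ℝ)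
    (D : Matrix (Fin Nd) ι ℝ) (S : Finset ι) :
    Matrix (Fin Ny × Fin Nd) (Fin Ny × Fin Nd) ℝ :=
  (1 : Matrix (Fin Ny) (Fin Ny) ℝ) ⊗ₖ (D * Dᵀ) -
    σe ^ 2 • ∑ t ∈ S, (regressor Ny (D.col t))ᵀ * sigmaTheta σe σw Θ * regressor Ny (D.col t)

/-- The matrix `C_i`: the expression for the bound on `θ` with the correction term of sample `i`
left out. -/
def cWithout [Fintype ι] [DecidableEq ι] (σe σw : ℝ) (Θ : Matrix (Fin Ny) (Fin Nd) ℝ)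
    (D : Matrix (Fin Nd) ι ℝ) (i : ι) : Matrix (Fin Ny × Fin Nd) (Fin Ny × Fin Nd) ℝ :=
  σw ^ 2 • (schurTheta σe σw Θ D (Finset.univ.erase i))⁻¹

/-- `I + (σe²/σw²) Θᵀ Θ - (σe²/σw⁴) Θᵀ H(d_i) C_i H(d_i)ᵀ Θ`. -/
def schurInput [Fintype ι] [DecidableEq ι] (σe σw : ℝ) (Θ : Matrix (Fin Ny) (Fin Nd) ℝ)
    (D : Matrix (Fin Nd) ι ℝ) (i : ι) : Matrix (Fin Nd) (Fin Nd) ℝ :=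
  1 + (σe ^ 2 / σw ^ 2) • (Θᵀ * Θ) -
    (σe ^ 2 / σw ^ 4) • (Θᵀ * regressor Ny (D.col i) * cWithout σe σw Θ D i *
      (regressor Ny (D.col i))ᵀ * Θ)

end Bounds

section Estimators

variable {α κ Z : Type*} [MeasurableSpace Z]

/-- The covariance matrix of a vector-valued statistic `T` under `μ`. -/
def covMat (μ : Measure Z) (T : Z → κ → ℝ) : Matrix κ κ ℝ :=
  Matrix.of fun a b => covariance (fun z => T z a) (fun z => T z b) μ

/-- `T` is a finite-variance estimator of `ψ p` that is locally unbiased at `p₀`: its bias and the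
gradient of its bias vanish at `p₀`. -/
structure IsLocallyUnbiased [Fintype α] (P : (α → ℝ) → Measure Z) (ψ : (α → ℝ) → κ → ℝ)
    (p₀ : α → ℝ) (T : Z → κ → ℝ) : Prop where
  memLp : ∀ a, MemLp (fun z => T z a) 2 (P p₀)
  bias_eq_zero : ∀ a, (∫ z, T z a ∂(P p₀)) - ψ p₀ a = 0
  gradient_bias_eq_zero :
    ∀ a, HasFDerivAt (fun p => (∫ z, T z a ∂(P p)) - ψ p a) (0 : (α → ℝ) →L[ℝ] ℝ) p₀

/-- A finite-variance estimator that is unbiased for all parameters near `p₀` is locally unbiased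
at `p₀`. -/
theorem IsLocallyUnbiased.of_eventually [Fintype α] {P : (α → ℝ) → Measure Z}
    {ψ : (α → ℝ) → κ → ℝ} {p₀ : α → ℝ} {T : Z → κ → ℝ}
    (hL : ∀ a, MemLp (fun z => T z a) 2 (P p₀))
    (hT : ∀ᶠ p in nhds p₀, ∀ a, ∫ z, T z a ∂(P p) = ψ p a) :
    IsLocallyUnbiased P ψ p₀ T where
  memLp := hL
  bias_eq_zero a := by rw [hT.self_of_nhds a, sub_self]
  gradient_bias_eq_zero a := by
    refine (hasFDerivAt_const (0 : ℝ) p₀).congr_of_eventuallyEq ?_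
    filter_upwards [hT] with p hp
    rw [hp a, sub_self]

end Estimators

end CCRB

end

/-! Listed as one real vector, the observations have independent Gaussian coordinates with known
variances, and their means are at most bilinear in `(Θ, d)`. The log-likelihood is therefore an
explicit sum of squares, the score is linear in the centred observations (`score_eq`), and `F = Jᵀ
V⁻¹ J`, where `J` is the Jacobian of the mean and `V` the diagonal noise covariance
(`fisherInfo_apply`). The blocks of `F` are read off from `J`, and `F` is positive definite because
`J` is injective once `D Dᵀ` is invertible (`fisherInfo_posDef`).

For the Cramér–Rao part, a change of mean is written as a density ratio. The derivative of `E_p T`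
in the direction of the parameter `a` is then `E[T S_a]` for every square-integrable `T`, with no
further regularity of `T` (`hasDerivAt_integral_obsLaw`). Local unbiasedness thus fixes the
covariances of `T` with the score, and the variance of `uᵀT - wᵀS` with a suitable `w` being
nonnegative gives the bound by a block of `F⁻¹` (`posSemidef_covMat_sub`).

The closed forms are Schur complements (`inv_toBlocks₁₁_inv`). Since `F` does not couple different
inputs, eliminating all inputs produces one correction per sample (`inv_thetaBlock_inv`).
Eliminating everything except `d_i` involves only the `θ`-block of the inverse of the reduced
matrix, because `d_i` is coupled to `θ` alone (`inv_inputBlock_inv`); that block is `C_i`. The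
matrices inverted in the bounds inherit positive definiteness from `F`. -/

namespace CCRB

/-! ### Products of Gaussian laws: density, moments, differentiation in the mean -/

section ProductGaussian

open scoped NNReal

variable {κ : Type*} [Fintype κ] (m : κ → ℝ) (v : κ → ℝ≥0)

/-- The product of the Gaussian laws `N(m k, v k)`. -/
noncomputable def gaussianPi : Measure (κ → ℝ) := Measure.pi fun k => gaussianReal (m k) (v k)

instance : IsProbabilityMeasure (gaussianPi m v) := by unfold gaussianPi; infer_instance

variable {m v}

theorem gaussianPi_eq_withDensity (hv : ∀ k, v k ≠ 0) :
    gaussianPi m v = volume.withDensity fun x =>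
      ENNReal.ofReal (∏ k, gaussianPDFReal (m k) (v k) (x k)) := by
  refine Measure.pi_eq fun s hs => ?_
  rw [withDensity_apply _ (MeasurableSet.univ_pi hs), volume_pi, Measure.restrict_pi_pi,
    ← ofReal_integral_eq_lintegral_ofReal, integral_fintype_prod_eq_prod,
    ENNReal.ofReal_prod_of_nonneg]
  · refine Finset.prod_congr rfl fun k _ => ?_
    rw [gaussianReal_apply_eq_integral _ (hv k)]
  · exact fun k _ => integral_nonneg fun x => gaussianPDFReal_nonneg _ _ _
  · exact Integrable.fintype_prod fun k => (integrable_gaussianPDFReal _ _).integrableOn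
  · exact Filter.Eventually.of_forall fun x =>
      Finset.prod_nonneg fun k _ => gaussianPDFReal_nonneg _ _ _

/-- With equal variances the terms quadratic in `x` cancel in the quotient of the densities, so the
exponent is affine in `x`. -/
theorem gaussianPDFReal_shift {a b x : ℝ} {w : ℝ≥0} (hw : w ≠ 0) :
    gaussianPDFReal b w x = gaussianPDFReal a w x *
      Real.exp (((x - a) * (b - a) - (b - a) ^ 2 / 2) / w) := by
  have : (w : ℝ) ≠ 0 := by exact_mod_cast hw
  simp only [gaussianPDFReal_def]
  rw [mul_assoc _ (Real.exp _), ← Real.exp_add]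
  congr 2
  field_simp
  ring

/-- Moves the dependence on the mean from the measure into a smooth weight, so that differentiating
in the mean asks no smoothness of `f`. -/
theorem integral_gaussianPi_shift (hv : ∀ k, v k ≠ 0) (δ : κ → ℝ) (f : (κ → ℝ) → ℝ) :
    ∫ x, f x ∂(gaussianPi (m + δ) v) =
      ∫ x, Real.exp (∑ k, ((x k - m k) * δ k - δ k ^ 2 / 2) / v k) * f x ∂(gaussianPi m v) := by
  have hmeas (m : κ → ℝ) : Measurable fun x : κ → ℝ =>
      ENNReal.ofReal (∏ k, gaussianPDFReal (m k) (v k) (x k)) := by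
    refine (Finset.measurable_prod _ fun k _ => ?_).ennreal_ofReal
    exact (measurable_gaussianPDFReal _ _).comp (measurable_pi_apply k)
  rw [gaussianPi_eq_withDensity hv, gaussianPi_eq_withDensity hv,
    integral_withDensity_eq_integral_toReal_smul (hmeas _) (by simp),
    integral_withDensity_eq_integral_toReal_smul (hmeas _) (by simp)]
  refine integral_congr_ae (Filter.Eventually.of_forall fun x => ?_)
  have h0 (m : κ → ℝ) : 0 ≤ ∏ k, gaussianPDFReal (m k) (v k) (x k) :=
    Finset.prod_nonneg fun k _ => gaussianPDFReal_nonneg _ _ _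
  simp only [ENNReal.toReal_ofReal (h0 _), smul_eq_mul, ← mul_assoc, Real.exp_sum,
    ← Finset.prod_mul_distrib]
  congr 1
  refine Finset.prod_congr rfl fun k _ => ?_
  rw [gaussianPDFReal_shift (a := m k) (hv k)]
  simp

theorem measurePreserving_eval_gaussianPi (k : κ) :
    MeasurePreserving (fun x : κ → ℝ => x k) (gaussianPi m v) (gaussianReal (m k) (v k)) :=
  measurePreserving_eval (fun k => gaussianReal (m k) (v k)) k

theorem memLp_eval_sub_gaussianPi (k : κ) :
    MemLp (fun x : κ → ℝ => x k - m k) 2 (gaussianPi m v) :=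
  ((memLp_id_gaussianReal' 2 (by simp)).comp_measurePreserving
    (measurePreserving_eval_gaussianPi k)).sub (memLp_const _)

theorem integral_eval_gaussianPi (k : κ) : ∫ x, x k ∂(gaussianPi m v) = m k := by
  have h := (measurePreserving_eval_gaussianPi (m := m) (v := v) k).map_eq
  rw [← integral_id_gaussianReal (μ := m k) (v := v k), ← h,
    integral_map (measurable_pi_apply k).aemeasurable (by fun_prop)]

theorem integral_eval_sub_gaussianPi (k : κ) : ∫ x, (x k - m k) ∂(gaussianPi m v) = 0 := by
  have hi : Integrable (fun x : κ → ℝ => x k) (gaussianPi m v) :=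
    ((memLp_id_gaussianReal 1).comp_measurePreserving
      (measurePreserving_eval_gaussianPi k)).integrable (by simp)
  rw [integral_sub hi (integrable_const _), integral_eval_gaussianPi]
  simp

theorem integral_mul_eval_sub_gaussianPi [DecidableEq κ] (k l : κ) :
    ∫ x, (x k - m k) * (x l - m l) ∂(gaussianPi m v) = if k = l then (v k : ℝ) else 0 := by
  have hcov : ∫ x, (x k - m k) * (x l - m l) ∂(gaussianPi m v) =
      covariance (fun x => x k) (fun x => x l) (gaussianPi m v) := by
    simp only [covariance, integral_eval_gaussianPi]
  have hL (k : κ) : MemLp (fun x : κ → ℝ => x k) 2 (gaussianPi m v) :=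
    (memLp_id_gaussianReal' 2 (by simp)).comp_measurePreserving
      (measurePreserving_eval_gaussianPi k)
  rw [hcov]
  split_ifs with h
  · subst h
    have h := (measurePreserving_eval_gaussianPi (m := m) (v := v) k).map_eq
    rw [covariance_self (measurable_pi_apply k).aemeasurable, ← variance_id_gaussianReal (μ := m k), ← h,
      variance_map (X := id) (Y := fun x : κ → ℝ => x k) (by fun_prop)
        (measurable_pi_apply k).aemeasurable]
    rfl
  · refine IndepFun.covariance_eq_zero ?_ (hL k) (hL l)
    exact (iIndepFun_pi (μ := fun k => gaussianReal (m k) (v k)) (X := fun _ => id)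
      fun _ => aemeasurable_id).indepFun h

/-- The exponential factorises over the coordinates, and each factor is controlled by the Gaussian
exponential moments at `α k` and `-α k`. Such functions serve as dominating functions below. -/
theorem integrable_exp_sum_abs_gaussianPi (α β : κ → ℝ) :
    Integrable (fun x : κ → ℝ => Real.exp (∑ k, (α k * |x k - m k| + β k))) (gaussianPi m v) := by
  simp only [Real.exp_sum]
  refine Integrable.fintype_prod (f := fun k y => Real.exp (α k * |y - m k| + β k)) fun k => ?_
  simp only [Real.exp_add]
  refine Integrable.mul_const ?_ _
  refine integrable_exp_mul_abs (X := fun y => y - m k) ?_ ?_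
  · simpa [mul_sub, Real.exp_sub, div_eq_mul_inv] using
      (integrable_exp_mul_gaussianReal (α k)).mul_const (Real.exp (α k * m k))⁻¹
  · simpa only [mul_sub, Real.exp_sub, div_eq_mul_inv] using
      (integrable_exp_mul_gaussianReal (-α k)).mul_const (Real.exp (-α k * m k))⁻¹

theorem memLp_exp_sum_abs_gaussianPi (α β : κ → ℝ) :
    MemLp (fun x : κ → ℝ => Real.exp (∑ k, (α k * |x k - m k| + β k))) 2 (gaussianPi m v) := by
  rw [memLp_two_iff_integrable_sq
    (by fun_prop : Continuous _).aestronglyMeasurable]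
  convert integrable_exp_sum_abs_gaussianPi (m := m) (v := v) (fun k => 2 * α k)
    (fun k => 2 * β k) using 2 with x
  rw [← Real.exp_nat_mul, Finset.mul_sum]
  congr 1
  exact Finset.sum_congr rfl fun k _ => by push_cast; ring

/-- Differentiation of an expectation along a quadratic curve of means. -/
theorem hasDerivAt_integral_gaussianPi (hv : ∀ k, v k ≠ 0) (a b : κ → ℝ) {f : (κ → ℝ) → ℝ}
    (hf : MemLp f 2 (gaussianPi m v)) :
    HasDerivAt (fun h : ℝ => ∫ x, f x ∂(gaussianPi (m + (h • a + h ^ 2 • b)) v))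
      (∫ x, f x * ∑ k, a k * (x k - m k) / v k ∂(gaussianPi m v)) 0 := by
  set δ : ℝ → κ → ℝ := fun h k => h * a k + h ^ 2 * b k with hδ
  set δ' : ℝ → κ → ℝ := fun h k => a k + 2 * h * b k with hδ'
  -- A common bound for the displacement `δ` and its derivative `δ'` when `|h| ≤ 1`; the factor 2
  -- comes from `δ'`.
  set c : κ → ℝ := fun k => |a k| + 2 * |b k| with hc
  set g : ℝ → (κ → ℝ) → ℝ := fun h x =>
    ∑ k, ((x k - m k) * δ h k - δ h k ^ 2 / 2) / v k with hg
  set g' : ℝ → (κ → ℝ) → ℝ := fun h x => ∑ k, (x k - m k - δ h k) * δ' h k / v k with hg'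
  -- One function bounding both `g` and `|g'|` uniformly in `|h| ≤ 1`.
  set B : (κ → ℝ) → ℝ := fun x => ∑ k, (c k / v k * |x k - m k| + c k ^ 2 / v k) with hB
  have hvp (k : κ) : (0 : ℝ) < v k := by exact_mod_cast pos_iff_ne_zero.mpr (hv k)
  have hδb {h : ℝ} (hh : |h| ≤ 1) (k : κ) : |δ h k| ≤ c k := by
    calc |δ h k| ≤ |h * a k| + |h ^ 2 * b k| := abs_add_le _ _
      _ = |h| * |a k| + |h| ^ 2 * |b k| := by rw [abs_mul, abs_mul, abs_pow]
      _ ≤ 1 * |a k| + 1 ^ 2 * |b k| := by gcongr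
      _ ≤ c k := by simp only [hc]; linarith [abs_nonneg (b k)]
  have hδb' {h : ℝ} (hh : |h| ≤ 1) (k : κ) : |δ' h k| ≤ c k := by
    calc |δ' h k| ≤ |a k| + |2 * h * b k| := abs_add_le _ _
      _ = |a k| + 2 * |h| * |b k| := by rw [abs_mul, abs_mul, abs_two]
      _ ≤ |a k| + 2 * 1 * |b k| := by gcongr
      _ = c k := by simp only [hc]; ring
  have hgb {h : ℝ} (hh : |h| ≤ 1) (x : κ → ℝ) : g h x ≤ B x := by
    refine Finset.sum_le_sum fun k _ => ?_
    rw [div_mul_eq_mul_div, ← add_div]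
    refine div_le_div_of_nonneg_right ?_ (hvp k).le
    have h1 : (x k - m k) * δ h k ≤ |x k - m k| * c k :=
      (le_abs_self _).trans ((abs_mul _ _).trans_le
        (mul_le_mul_of_nonneg_left (hδb hh k) (abs_nonneg _)))
    nlinarith [sq_nonneg (δ h k), sq_nonneg (c k)]
  have hgb' {h : ℝ} (hh : |h| ≤ 1) (x : κ → ℝ) : |g' h x| ≤ B x := by
    refine (Finset.abs_sum_le_sum_abs _ _).trans (Finset.sum_le_sum fun k _ => ?_)
    rw [div_mul_eq_mul_div, ← add_div, abs_div, abs_of_pos (hvp k), abs_mul]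
    refine div_le_div_of_nonneg_right ?_ (hvp k).le
    have h0 : 0 ≤ c k := by positivity
    calc |x k - m k - δ h k| * |δ' h k| ≤ (|x k - m k| + c k) * c k := by
          gcongr
          · exact (abs_sub _ _).trans (add_le_add_right (hδb hh k) _)
          · exact hδb' hh k
      _ = _ := by ring
  have hder (x : κ → ℝ) (h : ℝ) : HasDerivAt (fun h => g h x) (g' h x) h := by
    refine HasDerivAt.fun_sum fun k _ => ?_
    have h1 : HasDerivAt (fun h => δ h k) (δ' h k) h := by
      have := ((hasDerivAt_id h).mul_const (a k)).add (((hasDerivAt_id h).pow 2).mul_const (b k))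
      exact this.congr_deriv (by simp [hδ'])
    have := (((h1.const_mul (x k - m k)).sub ((h1.pow 2).div_const 2)).div_const (v k : ℝ))
    exact this.congr_deriv (by simp; ring)
  have hmain := (hasDerivAt_integral_of_dominated_loc_of_deriv_le (μ := gaussianPi m v)
    (F := fun h x => Real.exp (g h x) * f x) (F' := fun h x => Real.exp (g h x) * g' h x * f x)
    (x₀ := (0 : ℝ)) (s := Metric.ball 0 1)
    -- This is `exp (2B) * |f|`: from `|g'| ≤ B ≤ exp B` follows `exp g * |g'| ≤ exp (2B)`. It is
    -- integrable as a product of two square-integrable functions.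
    (bound := fun x => Real.exp (∑ k, (2 * (c k / v k) * |x k - m k| + 2 * (c k ^ 2 / v k))) * |f x|)
    (Metric.ball_mem_nhds _ one_pos) ?_ ?_ ?_ ?_ ?_ ?_).2
  · have hL (h : ℝ) : ∫ x, f x ∂(gaussianPi (m + (h • a + h ^ 2 • b)) v) =
        ∫ x, Real.exp (g h x) * f x ∂(gaussianPi m v) := integral_gaussianPi_shift hv _ f
    simp only [hL]
    refine hmain.congr_deriv ?_
    refine integral_congr_ae (Filter.Eventually.of_forall fun x => ?_)
    simp [hg, hg', hδ, hδ', mul_comm]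
  · refine Filter.Eventually.of_forall fun h => ?_
    exact (by fun_prop : Continuous fun x => Real.exp (g h x)).aestronglyMeasurable.mul hf.1
  · simpa [hg, hδ] using hf.integrable (by simp)
  · exact (by fun_prop : Continuous fun x => Real.exp (g 0 x) * g' 0 x).aestronglyMeasurable.mul hf.1
  · refine Filter.Eventually.of_forall fun x h hh => ?_
    have hh : |h| ≤ 1 := by
      rw [mem_ball_zero_iff, Real.norm_eq_abs] at hh
      exact hh.le
    rw [Real.norm_eq_abs, abs_mul, abs_mul, Real.abs_exp]
    refine mul_le_mul_of_nonneg_right ?_ (abs_nonneg _)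
    have h2 : ∑ k, (2 * (c k / v k) * |x k - m k| + 2 * (c k ^ 2 / v k)) = B x + B x := by
      rw [← two_mul, hB, Finset.mul_sum]
      exact Finset.sum_congr rfl fun k _ => by ring
    rw [h2, Real.exp_add]
    gcongr
    · exact hgb hh x
    · exact (hgb' hh x).trans (by linarith [Real.add_one_le_exp (B x)])
  · exact (memLp_exp_sum_abs_gaussianPi _ _).integrable_mul hf.abs
  · refine Filter.Eventually.of_forall fun x h _ => ?_
    exact ((hder x h).exp).mul_const (f x)

end ProductGaussian

/-! ### The model as one Gaussian vector: likelihood, score and Fisher information -/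

section Flattening

open scoped NNReal

variable {Ny Nd : ℕ} {ι : Type*}

/-- Index set of the scalar observations: `(t, inl k)` stands for `x_t k`, `(t, inr j)` for
`y_t j`. -/
abbrev ObsIdx (Ny Nd : ℕ) (ι : Type*) := ι × (Fin Nd ⊕ Fin Ny)

/-- The observations as one real vector. -/
def flatten : Obs Ny Nd ι ≃ᵐ (ObsIdx Ny Nd ι → ℝ) where
  toFun z c := Sum.elim (z c.1).1 (z c.1).2 c.2
  invFun x t := (fun k => x (t, Sum.inl k), fun j => x (t, Sum.inr j))
  left_inv _ := rfl
  right_inv x := by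
    ext ⟨t, k | j⟩ <;> rfl
  measurable_toFun := by
    refine measurable_pi_lambda _ ?_
    rintro ⟨t, k | j⟩
    · exact (measurable_pi_apply k).comp (measurable_pi_apply t).fst
    · exact (measurable_pi_apply j).comp (measurable_pi_apply t).snd
  measurable_invFun := by
    refine measurable_pi_lambda _ fun t => Measurable.prodMk ?_ ?_ <;>
    exact measurable_pi_lambda _ fun _ => measurable_pi_apply _

@[simp] theorem flatten_inl (z : Obs Ny Nd ι) (t : ι) (k : Fin Nd) :
    flatten z (t, Sum.inl k) = (z t).1 k := rfl

@[simp] theorem flatten_inr (z : Obs Ny Nd ι) (t : ι) (j : Fin Ny) :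
    flatten z (t, Sum.inr j) = (z t).2 j := rfl

/-- The means of the scalar observations. -/
def meanMap (p : ParamIdx Ny Nd ι → ℝ) (c : ObsIdx Ny Nd ι) : ℝ :=
  Sum.elim (inputOf p c.1) (thetaOf p *ᵥ inputOf p c.1) c.2

variable (Ny Nd ι) in
/-- The variances of the scalar observations. -/
noncomputable def noiseVar (σe σw : ℝ) (c : ObsIdx Ny Nd ι) : ℝ≥0 :=
  Sum.elim (fun _ => (σe ^ 2).toNNReal) (fun _ => (σw ^ 2).toNNReal) c.2

theorem noiseVar_ne_zero {σe σw : ℝ} (hσe : 0 < σe) (hσw : 0 < σw) (c : ObsIdx Ny Nd ι) :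
    noiseVar Ny Nd ι σe σw c ≠ 0 := by
  obtain ⟨t, k | j⟩ := c <;> simp [noiseVar, hσe.ne', hσw.ne']

/-- The derivative of the means of the scalar observations at the parameter `p`. -/
def meanDeriv (p : ParamIdx Ny Nd ι → ℝ) :
    (ParamIdx Ny Nd ι → ℝ) →ₗ[ℝ] (ObsIdx Ny Nd ι → ℝ) where
  toFun q c := Sum.elim (inputOf q c.1)
    (thetaOf p *ᵥ inputOf q c.1 + thetaOf q *ᵥ inputOf p c.1) c.2
  map_add' q r := by
    ext ⟨t, k | j⟩
    · rfl
    · have h1 : thetaOf (q + r) = thetaOf q + thetaOf r := rfl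
      have h2 : inputOf (q + r) t = inputOf q t + inputOf r t := rfl
      simp only [Sum.elim_inr, Pi.add_apply, h1, h2, mulVec_add, add_mulVec]
      ring
  map_smul' a q := by
    ext ⟨t, k | j⟩
    · rfl
    · have h1 : thetaOf (a • q) = a • thetaOf q := rfl
      have h2 : inputOf (a • q) t = a • inputOf q t := rfl
      simp only [Sum.elim_inr, Pi.add_apply, h1, h2, mulVec_smul, smul_mulVec, Pi.smul_apply,
        RingHom.id_apply, smul_add]

/-- The product `Θ d` is bilinear, so the expansion along a line stops exactly at second order. This
is why `hasDerivAt_integral_gaussianPi` treats quadratic curves of means. -/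
theorem meanMap_line (p q : ParamIdx Ny Nd ι → ℝ) (h : ℝ) :
    meanMap (p + h • q) = meanMap p + (h • meanDeriv p q + h ^ 2 •
      fun c => Sum.elim (fun _ => 0) (thetaOf q *ᵥ inputOf q c.1) c.2) := by
  ext ⟨t, k | j⟩
  · simp [meanMap, meanDeriv, inputOf]
  · have h1 : thetaOf (p + h • q) = thetaOf p + h • thetaOf q := rfl
    have h2 : inputOf (p + h • q) t = inputOf p t + h • inputOf q t := rfl
    simp only [meanMap, meanDeriv, Sum.elim_inr, h1, h2, Pi.add_apply, Pi.smul_apply, mulVec_add,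
      add_mulVec, mulVec_smul, smul_mulVec, smul_eq_mul, LinearMap.coe_mk, AddHom.coe_mk]
    ring

variable [Fintype ι]

/-- A product measure is determined by its values on boxes, and the preimage of a box is again a
product of boxes. -/
theorem measurePreserving_flatten (μ : Fin Nd → Measure ℝ) (ν : Fin Ny → Measure ℝ)
    [∀ k, SigmaFinite (μ k)] [∀ j, SigmaFinite (ν j)] :
    MeasurePreserving (flatten (Ny := Ny) (Nd := Nd) (ι := ι))
      (Measure.pi fun _ => (Measure.pi μ).prod (Measure.pi ν))
      (Measure.pi fun c => Sum.elim μ ν c.2) := by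
  have : ∀ c : ObsIdx Ny Nd ι, SigmaFinite (Sum.elim μ ν c.2) := by
    rintro ⟨t, k | j⟩ <;> simp only [Sum.elim_inl, Sum.elim_inr] <;> infer_instance
  refine ⟨flatten.measurable, (Measure.pi_eq fun s hs => ?_).symm⟩
  have hpre : flatten (Ny := Ny) (Nd := Nd) (ι := ι) ⁻¹' Set.univ.pi s = Set.univ.pi fun t =>
      (Set.univ.pi fun k => s (t, Sum.inl k)) ×ˢ (Set.univ.pi fun j => s (t, Sum.inr j)) := by
    ext z
    simp [Set.mem_pi, Prod.forall, forall_and]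
  rw [flatten.map_apply, hpre, Measure.pi_pi]
  simp [Measure.prod_prod, Measure.pi_pi, Fintype.prod_prod_type, Fintype.prod_sum_type]

theorem map_flatten_volume :
    (volume : Measure (Obs Ny Nd ι)).map flatten = volume := by
  refine (measurePreserving_flatten (ι := ι) (fun _ : Fin Nd => (volume : Measure ℝ))
    (fun _ : Fin Ny => (volume : Measure ℝ))).map_eq.trans ?_
  rw [volume_pi]
  congr 1
  ext1 ⟨t, k | j⟩ <;> rfl

theorem map_flatten_obsLaw (σe σw : ℝ) (p : ParamIdx Ny Nd ι → ℝ) :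
    (obsLaw σe σw p).map flatten = gaussianPi (meanMap p) (noiseVar Ny Nd ι σe σw) := by
  have hshift : Measurable fun (n : Obs Ny Nd ι) t =>
      (inputOf p t + (n t).1, thetaOf p *ᵥ inputOf p t + (n t).2) := by
    refine measurable_pi_lambda _ fun t => Measurable.prodMk ?_ ?_
    · exact (measurable_pi_apply t).fst.const_add _
    · exact (measurable_pi_apply t).snd.const_add _
  have hadd : Measurable fun x : ObsIdx Ny Nd ι → ℝ => fun c => meanMap p c + x c := by fun_prop
  have hcomp : (flatten ∘ fun (n : Obs Ny Nd ι) t =>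
      (inputOf p t + (n t).1, thetaOf p *ᵥ inputOf p t + (n t).2)) =
      (fun x : ObsIdx Ny Nd ι → ℝ => fun c => meanMap p c + x c) ∘ flatten := by
    funext n c
    obtain ⟨t, k | j⟩ := c <;> rfl
  have hpi := (measurePreserving_flatten (ι := ι)
    (fun _ : Fin Nd => gaussianReal 0 (σe ^ 2).toNNReal)
    (fun _ : Fin Ny => gaussianReal 0 (σw ^ 2).toNNReal)).map_eq
  have hsum (c : ObsIdx Ny Nd ι) : Sum.elim (fun _ : Fin Nd => gaussianReal 0 (σe ^ 2).toNNReal)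
      (fun _ : Fin Ny => gaussianReal 0 (σw ^ 2).toNNReal) c.2 =
        gaussianReal 0 (noiseVar Ny Nd ι σe σw c) := by
    obtain ⟨t, k | j⟩ := c <;> rfl
  simp only [hsum] at hpi
  have hg (c : ObsIdx Ny Nd ι) : (gaussianReal 0 (noiseVar Ny Nd ι σe σw c)).map
      (fun x => meanMap p c + x) = gaussianReal (meanMap p c) (noiseVar Ny Nd ι σe σw c) := by
    rw [gaussianReal_map_const_add, zero_add]
  have hsf (c : ObsIdx Ny Nd ι) : SigmaFinite ((gaussianReal 0 (noiseVar Ny Nd ι σe σw c)).map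
      (fun x => meanMap p c + x)) := by
    rw [hg]; infer_instance
  rw [obsLaw, Measure.map_map flatten.measurable hshift, hcomp,
    ← Measure.map_map hadd flatten.measurable]
  refine (congrArg _ hpi).trans ?_
  rw [Measure.pi_map_pi fun c => by fun_prop, gaussianPi]
  simp only [hg]

theorem measurePreserving_flatten_obsLaw (σe σw : ℝ) (p : ParamIdx Ny Nd ι → ℝ) :
    MeasurePreserving flatten (obsLaw σe σw p)
      (gaussianPi (meanMap p) (noiseVar Ny Nd ι σe σw)) :=
  ⟨flatten.measurable, map_flatten_obsLaw σe σw p⟩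

instance (σe σw : ℝ) (p : ParamIdx Ny Nd ι → ℝ) : IsProbabilityMeasure (obsLaw σe σw p) := by
  have h := (measurePreserving_flatten_obsLaw σe σw p).symm
  rw [← h.map_eq]
  exact Measure.isProbabilityMeasure_map h.measurable.aemeasurable

theorem likelihood_eq_prod (σe σw : ℝ) (p : ParamIdx Ny Nd ι → ℝ) (z : Obs Ny Nd ι) :
    likelihood σe σw p z =
      ∏ c, gaussianPDFReal (meanMap p c) (noiseVar Ny Nd ι σe σw c) (flatten z c) := by
  simp [likelihood, Fintype.prod_prod_type, Fintype.prod_sum_type, meanMap, noiseVar]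

/-- Pushforward along the measurable equivalence `flatten` is injective on measures, so the density
can be compared after flattening. -/
theorem obsLaw_eq_withDensity {σe σw : ℝ} (hσe : 0 < σe) (hσw : 0 < σw)
    (p : ParamIdx Ny Nd ι → ℝ) :
    obsLaw σe σw p = volume.withDensity fun z => ENNReal.ofReal (likelihood σe σw p z) := by
  refine flatten.map_measurableEquiv_injective ?_
  rw [map_flatten_obsLaw, gaussianPi_eq_withDensity (noiseVar_ne_zero hσe hσw),
    ← map_flatten_volume]
  simp only [likelihood_eq_prod]
  ext s hs
  rw [withDensity_apply _ hs, flatten.map_apply, flatten.restrict_map, lintegral_map_equiv,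
    withDensity_apply _ (flatten.measurable hs)]

theorem log_likelihood {σe σw : ℝ} (hσe : 0 < σe) (hσw : 0 < σw) (p : ParamIdx Ny Nd ι → ℝ)
    (z : Obs Ny Nd ι) :
    Real.log (likelihood σe σw p z) =
      ∑ c, (Real.log (√(2 * Real.pi * noiseVar Ny Nd ι σe σw c))⁻¹ -
        (flatten z c - meanMap p c) ^ 2 / (2 * noiseVar Ny Nd ι σe σw c)) := by
  have hv (c : ObsIdx Ny Nd ι) : (0 : ℝ) < noiseVar Ny Nd ι σe σw c := by
    exact_mod_cast pos_iff_ne_zero.mpr (noiseVar_ne_zero hσe hσw c)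
  rw [likelihood_eq_prod, Real.log_prod fun c _ =>
    (gaussianPDFReal_pos _ _ _ (noiseVar_ne_zero hσe hσw c)).ne']
  refine Finset.sum_congr rfl fun c _ => ?_
  have := hv c
  rw [gaussianPDFReal, Real.log_mul (by positivity) (Real.exp_ne_zero _), Real.log_exp]
  ring

theorem differentiableAt_log_likelihood {σe σw : ℝ} (hσe : 0 < σe) (hσw : 0 < σw)
    (p : ParamIdx Ny Nd ι → ℝ) (z : Obs Ny Nd ι) :
    DifferentiableAt ℝ (fun q => Real.log (likelihood σe σw q z)) p := by
  have hm (c : ObsIdx Ny Nd ι) : Differentiable ℝ fun q : ParamIdx Ny Nd ι → ℝ => meanMap q c := by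
    obtain ⟨t, k | j⟩ := c
    · simp only [meanMap, inputOf, Sum.elim_inl]
      fun_prop
    · simp only [meanMap, inputOf, thetaOf, Sum.elim_inr, mulVec, dotProduct, of_apply]
      fun_prop
  simp only [log_likelihood hσe hσw]
  fun_prop

theorem hasDerivAt_log_likelihood {σe σw : ℝ} (hσe : 0 < σe) (hσw : 0 < σw)
    (p q : ParamIdx Ny Nd ι → ℝ) (z : Obs Ny Nd ι) :
    HasDerivAt (fun h : ℝ => Real.log (likelihood σe σw (p + h • q) z))
      (∑ c, meanDeriv p q c * (flatten z c - meanMap p c) / noiseVar Ny Nd ι σe σw c) 0 := by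
  simp only [log_likelihood hσe hσw, meanMap_line]
  refine HasDerivAt.fun_sum fun c _ => ?_
  have hv : (noiseVar Ny Nd ι σe σw c : ℝ) ≠ 0 := by
    exact_mod_cast noiseVar_ne_zero hσe hσw c
  set b := (Sum.elim (fun _ => 0) (thetaOf q *ᵥ inputOf q c.1) c.2 : ℝ) with hb
  have h1 : HasDerivAt (fun h : ℝ => meanMap p c + (h * meanDeriv p q c + h ^ 2 * b))
      (meanDeriv p q c) 0 := by
    have := (((hasDerivAt_id (0 : ℝ)).mul_const (meanDeriv p q c)).add
      (((hasDerivAt_id (0 : ℝ)).pow 2).mul_const b)).const_add (meanMap p c)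
    exact this.congr_deriv (by simp)
  have h2 := ((((h1.const_sub (flatten z c)).pow 2).div_const
    (2 * (noiseVar Ny Nd ι σe σw c : ℝ))).const_sub
      (Real.log (√(2 * Real.pi * noiseVar Ny Nd ι σe σw c))⁻¹))
  refine h2.congr_deriv ?_
  simp
  field_simp

variable [DecidableEq ι]

/-- The Fréchet derivative exists, so its value on a basis vector is the derivative along the
corresponding line, where the log-likelihood is explicit. -/
theorem score_eq {σe σw : ℝ} (hσe : 0 < σe) (hσw : 0 < σw) (p : ParamIdx Ny Nd ι → ℝ)
    (a : ParamIdx Ny Nd ι) (z : Obs Ny Nd ι) :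
    score σe σw p a z = ∑ c, meanDeriv p (Pi.single a 1) c * (flatten z c - meanMap p c) /
      noiseVar Ny Nd ι σe σw c := by
  rw [score, ← (differentiableAt_log_likelihood hσe hσw p z).lineDeriv_eq_fderiv]
  exact (hasDerivAt_log_likelihood hσe hσw p _ z).deriv

theorem memLp_score {σe σw : ℝ} (hσe : 0 < σe) (hσw : 0 < σw) (p : ParamIdx Ny Nd ι → ℝ)
    (a : ParamIdx Ny Nd ι) : MemLp (score σe σw p a) 2 (obsLaw σe σw p) := by
  have h : MemLp (fun x : ObsIdx Ny Nd ι → ℝ => ∑ c, meanDeriv p (Pi.single a 1) c *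
      (x c - meanMap p c) / noiseVar Ny Nd ι σe σw c) 2
      (gaussianPi (meanMap p) (noiseVar Ny Nd ι σe σw)) := by
    refine memLp_finsetSum _ fun c _ => ?_
    simp only [div_eq_mul_inv]
    exact ((memLp_eval_sub_gaussianPi c).const_mul _).mul_const _
  have hs : score σe σw p a = (fun x : ObsIdx Ny Nd ι → ℝ => ∑ c, meanDeriv p (Pi.single a 1) c *
      (x c - meanMap p c) / noiseVar Ny Nd ι σe σw c) ∘ flatten := funext (score_eq hσe hσw p a)
  rw [hs]
  exact h.comp_measurePreserving (measurePreserving_flatten_obsLaw σe σw p)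

theorem integral_score {σe σw : ℝ} (hσe : 0 < σe) (hσw : 0 < σw) (p : ParamIdx Ny Nd ι → ℝ)
    (a : ParamIdx Ny Nd ι) : ∫ z, score σe σw p a z ∂(obsLaw σe σw p) = 0 := by
  simp only [score_eq hσe hσw]
  rw [(measurePreserving_flatten_obsLaw σe σw p).integral_comp flatten.measurableEmbedding
    (fun x => ∑ c, meanDeriv p (Pi.single a 1) c * (x c - meanMap p c) /
      noiseVar Ny Nd ι σe σw c), integral_finsetSum]
  · refine Finset.sum_eq_zero fun c _ => ?_
    rw [integral_div, integral_const_mul, integral_eval_sub_gaussianPi, mul_zero, zero_div]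
  · exact fun c _ =>
      (((memLp_eval_sub_gaussianPi c).integrable (by simp)).const_mul _).div_const _

/-- Distinct centred observations are uncorrelated, so only the diagonal terms of the double sum
survive. This is the entrywise form of `Jᵀ V⁻¹ J`. -/
theorem fisherInfo_apply {σe σw : ℝ} (hσe : 0 < σe) (hσw : 0 < σw) (p : ParamIdx Ny Nd ι → ℝ)
    (a b : ParamIdx Ny Nd ι) :
    fisherInfo σe σw p a b = ∑ c, meanDeriv p (Pi.single a 1) c * meanDeriv p (Pi.single b 1) c /
      noiseVar Ny Nd ι σe σw c := by
  classical
  have hI (c d : ObsIdx Ny Nd ι) : Integrable (fun x : ObsIdx Ny Nd ι → ℝ =>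
      meanDeriv p (Pi.single a 1) c * meanDeriv p (Pi.single b 1) d /
        (noiseVar Ny Nd ι σe σw c * noiseVar Ny Nd ι σe σw d) *
        ((x c - meanMap p c) * (x d - meanMap p d)))
      (gaussianPi (meanMap p) (noiseVar Ny Nd ι σe σw)) :=
    ((memLp_eval_sub_gaussianPi c).integrable_mul (memLp_eval_sub_gaussianPi d)).const_mul _
  have hv (c : ObsIdx Ny Nd ι) : (noiseVar Ny Nd ι σe σw c : ℝ) ≠ 0 := by
    exact_mod_cast noiseVar_ne_zero hσe hσw c
  simp only [fisherInfo, of_apply, score_eq hσe hσw]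
  rw [(measurePreserving_flatten_obsLaw σe σw p).integral_comp flatten.measurableEmbedding
    (fun x => (∑ c, meanDeriv p (Pi.single a 1) c * (x c - meanMap p c) /
      noiseVar Ny Nd ι σe σw c) * ∑ c, meanDeriv p (Pi.single b 1) c * (x c - meanMap p c) /
      noiseVar Ny Nd ι σe σw c)]
  have hexp (x : ObsIdx Ny Nd ι → ℝ) : (∑ c, meanDeriv p (Pi.single a 1) c *
      (x c - meanMap p c) / noiseVar Ny Nd ι σe σw c) *
      (∑ c, meanDeriv p (Pi.single b 1) c * (x c - meanMap p c) / noiseVar Ny Nd ι σe σw c) =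
      ∑ c, ∑ d, meanDeriv p (Pi.single a 1) c * meanDeriv p (Pi.single b 1) d /
        (noiseVar Ny Nd ι σe σw c * noiseVar Ny Nd ι σe σw d) *
        ((x c - meanMap p c) * (x d - meanMap p d)) := by
    rw [Finset.sum_mul_sum]
    refine Finset.sum_congr rfl fun c _ => Finset.sum_congr rfl fun d _ => ?_
    have := hv c
    have := hv d
    field_simp
  simp only [hexp]
  rw [integral_finsetSum _ fun c _ => integrable_finsetSum _ fun d _ => hI c d]
  refine Finset.sum_congr rfl fun c _ => ?_
  rw [integral_finsetSum _ fun d _ => hI c d]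
  simp only [integral_const_mul, integral_mul_eval_sub_gaussianPi, mul_ite, mul_zero,
    Finset.sum_ite_eq, Finset.mem_univ, if_true]
  have := hv c
  field_simp

/-- The regularity condition of the Cramér–Rao inequality, automatic here for every
square-integrable statistic. Coordinate lines suffice, since only partial derivatives of the bias
are needed. -/
theorem hasDerivAt_integral_obsLaw {σe σw : ℝ} (hσe : 0 < σe) (hσw : 0 < σw)
    (p : ParamIdx Ny Nd ι → ℝ) (a : ParamIdx Ny Nd ι) {f : Obs Ny Nd ι → ℝ}
    (hf : MemLp f 2 (obsLaw σe σw p)) :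
    HasDerivAt (fun h : ℝ => ∫ z, f z ∂(obsLaw σe σw (p + h • Pi.single a 1)))
      (∫ z, f z * score σe σw p a z ∂(obsLaw σe σw p)) 0 := by
  have hint (q : ParamIdx Ny Nd ι → ℝ) (f : Obs Ny Nd ι → ℝ) : ∫ z, f z ∂(obsLaw σe σw q) =
      ∫ x, f (flatten.symm x) ∂(gaussianPi (meanMap q) (noiseVar Ny Nd ι σe σw)) := by
    rw [← (measurePreserving_flatten_obsLaw σe σw q).integral_comp flatten.measurableEmbedding]
    simp
  simp only [hint, meanMap_line, score_eq hσe hσw, MeasurableEquiv.apply_symm_apply]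
  exact hasDerivAt_integral_gaussianPi (noiseVar_ne_zero hσe hσw) _ _
    (hf.comp_measurePreserving (measurePreserving_flatten_obsLaw σe σw p).symm)

end Flattening

/-! ### Inverses of scaled and block matrices -/

section LinearAlgebra

variable {m n : Type*} [Fintype m] [DecidableEq m] [Fintype n] [DecidableEq n]

/-- For singular `A` both sides are zero by the convention for `⁻¹`, so no invertibility is
required. -/
theorem inv_smul_real {k : ℝ} (hk : k ≠ 0) (A : Matrix n n ℝ) : (k • A)⁻¹ = k⁻¹ • A⁻¹ := by
  by_cases h : IsUnit A.det
  · refine inv_eq_left_inv ?_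
    rw [smul_mul_smul_comm, nonsing_inv_mul _ h, inv_mul_cancel₀ hk, one_smul]
  · rw [nonsing_inv_apply_not_isUnit _ h, smul_zero, nonsing_inv_apply_not_isUnit]
    rw [det_smul, isUnit_iff_ne_zero, mul_ne_zero_iff, not_and_or]
    exact Or.inr (by rwa [isUnit_iff_ne_zero] at h)

/-- The inverse of a diagonal block of the inverse is the Schur complement. -/
theorem inv_toBlocks₁₁_inv {P : Matrix (m ⊕ n) (m ⊕ n) ℝ} (hP : P.PosDef) :
    (P⁻¹.toBlocks₁₁)⁻¹ =
      P.toBlocks₁₁ - P.toBlocks₁₂ * P.toBlocks₂₂⁻¹ * P.toBlocks₂₁ := by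
  have h22 : IsUnit P.toBlocks₂₂.det :=
    (isUnit_iff_isUnit_det _).mp (hP.submatrix (e := Sum.inr) Sum.inr_injective).isUnit
  have hmul : P * P⁻¹ = 1 := mul_nonsing_inv _ ((isUnit_iff_isUnit_det _).mp hP.isUnit)
  rw [← fromBlocks_toBlocks P⁻¹] at hmul
  nth_rewrite 1 [← fromBlocks_toBlocks P] at hmul
  rw [fromBlocks_multiply, ← fromBlocks_one, fromBlocks_inj] at hmul
  obtain ⟨h1, -, h3, -⟩ := hmul
  -- The lower left block of `P * P⁻¹ = 1` is solved for this block; substituted into the upper left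
  -- one, it exhibits the Schur complement as a left inverse.
  have hZ : P⁻¹.toBlocks₂₁ = -(P.toBlocks₂₂⁻¹ * P.toBlocks₂₁ * P⁻¹.toBlocks₁₁) := by
    have := congrArg (P.toBlocks₂₂⁻¹ * ·) h3
    simp only [Matrix.mul_add, ← Matrix.mul_assoc, nonsing_inv_mul _ h22, Matrix.one_mul,
      Matrix.mul_zero] at this
    exact eq_neg_of_add_eq_zero_right this
  refine inv_eq_left_inv ?_
  rw [hZ] at h1
  rw [← h1, Matrix.sub_mul, Matrix.mul_neg, sub_eq_add_neg]
  simp only [Matrix.mul_assoc]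

end LinearAlgebra

/-! ### The Cramér–Rao inequality -/

section CramerRao

variable {α κ Z : Type*} [Fintype α] [DecidableEq α] [Fintype κ] [MeasurableSpace Z]

/-- The Cramér–Rao bound for statistics whose covariance with the score is a coordinate map. -/
theorem posSemidef_covMat_sub {μ : Measure Z} [IsProbabilityMeasure μ] {S : α → Z → ℝ}
    {F : Matrix α α ℝ} (hS : ∀ a, MemLp (S a) 2 μ) (hS0 : ∀ a, ∫ z, S a z ∂μ = 0)
    (hF : ∀ a b, F a b = ∫ z, S a z * S b z ∂μ) (hpd : F.PosDef) (e : κ → α) {T : Z → κ → ℝ}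
    (hT : ∀ a, MemLp (fun z => T z a) 2 μ)
    (hTS : ∀ a b, ∫ z, T z a * S b z ∂μ = (Pi.single b 1 : α → ℝ) (e a)) :
    (covMat μ T - F⁻¹.submatrix e e).PosSemidef := by
  classical
  have hcov (a : κ) (b : α) : covariance (fun z => T z a) (S b) μ =
      (Pi.single b 1 : α → ℝ) (e a) := by
    rw [covariance_eq_sub (hT a) (hS b), hS0, mul_zero, sub_zero]
    exact hTS a b
  have hcovS (a b : α) : covariance (S a) (S b) μ = F a b := by
    rw [covariance_eq_sub (hS a) (hS b), hS0, zero_mul, sub_zero, hF]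
    rfl
  have hsymm : F⁻¹.IsHermitian := hpd.inv.isHermitian
  refine PosSemidef.of_dotProduct_mulVec_nonneg ?_ fun u => ?_
  · refine IsHermitian.sub ?_ (hsymm.submatrix e)
    ext a b
    simp [covMat, covariance_comm]
  -- The coefficients of the `L²` projection of `uᵀT - E[uᵀT]` onto the span of the scores: `F w` is
  -- the vector of covariances of `uᵀT` with the score.
  · set w : α → ℝ := ∑ a, u a • F⁻¹.col (e a) with hw
    have hFw : F *ᵥ w = ∑ a, u a • Pi.single (e a) (1 : ℝ) := by
      rw [hw, mulVec_sum]
      refine Finset.sum_congr rfl fun a _ => ?_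
      have : F⁻¹.col (e a) = F⁻¹ *ᵥ Pi.single (e a) 1 := by simp
      rw [mulVec_smul, this, mulVec_mulVec,
        mul_nonsing_inv _ ((isUnit_iff_isUnit_det _).mp hpd.isUnit), one_mulVec]
    have hUm : MemLp (fun z => ∑ a, u a * T z a) 2 μ :=
      memLp_finsetSum _ fun a _ => (hT a).const_mul _
    have hWm : MemLp (fun z => ∑ b, w b * S b z) 2 μ :=
      memLp_finsetSum _ fun b _ => (hS b).const_mul _
    -- With this `w`, the cross covariance and the variance of `wᵀS` both equal the quadratic form
    -- of the block of `F⁻¹` at `u`, so this variance is the quadratic form to be shown nonnegative.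
    have hvar := variance_nonneg (fun z => (∑ a, u a * T z a) - ∑ b, w b * S b z) μ
    rw [variance_fun_sub hUm hWm] at hvar
    have hUU : variance (fun z => ∑ a, u a * T z a) μ = u ⬝ᵥ (covMat μ T *ᵥ u) := by
      rw [← covariance_self hUm.1.aemeasurable,
        covariance_fun_sum_fun_sum (fun a => (hT a).const_mul _) (fun a => (hT a).const_mul _)]
      simp only [covariance_const_mul_left, covariance_const_mul_right, dotProduct, mulVec,
        Finset.mul_sum, covMat, of_apply]
      refine Finset.sum_congr rfl fun a _ => Finset.sum_congr rfl fun b _ => by ring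
    have hWW : variance (fun z => ∑ b, w b * S b z) μ = w ⬝ᵥ (F *ᵥ w) := by
      rw [← covariance_self hWm.1.aemeasurable,
        covariance_fun_sum_fun_sum (fun a => (hS a).const_mul _) (fun a => (hS a).const_mul _)]
      simp only [covariance_const_mul_left, covariance_const_mul_right, dotProduct, mulVec,
        Finset.mul_sum, hcovS]
      refine Finset.sum_congr rfl fun a _ => Finset.sum_congr rfl fun b _ => by ring
    have hUW : covariance (fun z => ∑ a, u a * T z a) (fun z => ∑ b, w b * S b z) μ =
        ∑ a, u a * w (e a) := by
      rw [covariance_fun_sum_fun_sum (fun a => (hT a).const_mul _) (fun a => (hS a).const_mul _)]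
      simp only [covariance_const_mul_left, covariance_const_mul_right, hcov]
      refine Finset.sum_congr rfl fun a _ => ?_
      simp [Pi.single_apply, mul_comm]
    have hq1 : w ⬝ᵥ (F *ᵥ w) = ∑ a, u a * w (e a) := by
      rw [hFw, dotProduct_sum]
      simp
    have hq2 : u ⬝ᵥ (F⁻¹.submatrix e e *ᵥ u) = ∑ a, u a * w (e a) := by
      simp only [dotProduct, mulVec, hw, submatrix_apply, Finset.sum_apply, Pi.smul_apply,
        col_apply, smul_eq_mul]
      refine Finset.sum_congr rfl fun a _ => ?_
      congr 1
      exact Finset.sum_congr rfl fun b _ => mul_comm _ _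
    rw [star_trivial, sub_mulVec, dotProduct_sub, hq2]
    rw [hUU, hWW, hUW, hq1] at hvar
    linarith

end CramerRao

/-! ### Elimination of nuisance parameters -/

section Schur

variable {Ny Nd : ℕ} {ι : Type*}

theorem deleteInput_posDef {F : Matrix (ParamIdx Ny Nd ι) (ParamIdx Ny Nd ι) ℝ} (hF : F.PosDef)
    (i : ι) : (deleteInput F i).PosDef :=
  hF.submatrix (Sum.map_injective.mpr ⟨Function.injective_id,
    Subtype.val_injective.prodMap Function.injective_id⟩)

variable [Fintype ι] [DecidableEq ι]

theorem thetaBlock_inv_posDef {F : Matrix (ParamIdx Ny Nd ι) (ParamIdx Ny Nd ι) ℝ}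
    (hF : F.PosDef) : (thetaBlock F⁻¹).PosDef :=
  hF.inv.submatrix Sum.inl_injective

/-- Elimination of the inputs when the inputs are uncorrelated across samples. -/
theorem inv_thetaBlock_inv {F : Matrix (ParamIdx Ny Nd ι) (ParamIdx Ny Nd ι) ℝ} (hF : F.PosDef)
    {M : Matrix (Fin Nd) (Fin Nd) ℝ} (hM : ∀ t, inputBlock F t t = M)
    (h0 : ∀ s t, s ≠ t → inputBlock F s t = 0) :
    (thetaBlock F⁻¹)⁻¹ =
      thetaBlock F - ∑ t, crossBlock F t * M⁻¹ * (crossBlock F t)ᵀ := by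
  refine (inv_toBlocks₁₁_inv hF).trans ?_
  -- Block diagonal with equal blocks, so its inverse is `1 ⊗ₖ M⁻¹` and the Schur correction splits
  -- into a sum over samples.
  have h22 : F.toBlocks₂₂ = (1 : Matrix ι ι ℝ) ⊗ₖ M := by
    ext ⟨s, k⟩ ⟨t, l⟩
    by_cases hst : s = t
    · subst hst
      simpa [toBlocks₂₂, inputBlock] using congrFun₂ (hM s) k l
    · simpa [toBlocks₂₂, inputBlock, hst] using congrFun₂ (h0 s t hst) k l
  have hsymm (a b : ParamIdx Ny Nd ι) : F a b = F b a := by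
    simpa using hF.isHermitian.apply b a
  rw [h22, inv_kronecker, inv_one]
  refine congrArg (thetaBlock F - ·) ?_
  ext a b
  rw [Matrix.sum_apply]
  simp only [mul_apply, Fintype.sum_prod_type, kroneckerMap_apply, one_apply, toBlocks₁₂,
    toBlocks₂₁, of_apply, crossBlock, submatrix_apply, transpose_apply]
  refine Finset.sum_congr rfl fun t _ => Finset.sum_congr rfl fun k _ => ?_
  rw [hsymm (Sum.inr (t, k))]
  congr 1
  rw [Finset.sum_eq_single t (by intro s _ hs; simp [hs]) (by simp)]
  simp

/-- The parameters, with the input `i` moved to the front. -/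
noncomputable def splitInput (i : ι) :
    Fin Nd ⊕ ParamIdx Ny Nd {t // t ≠ i} ≃ ParamIdx Ny Nd ι :=
  Equiv.ofBijective (Sum.elim (fun k => Sum.inr (i, k)) (Sum.map id (Prod.map Subtype.val id))) <| by
    constructor
    · rintro (k | a | ⟨⟨t, ht⟩, k⟩) (l | b | ⟨⟨s, hs⟩, l⟩) h <;>
        simp_all [Prod.ext_iff, eq_comm] <;> exact absurd h.1.symm ‹_›
    · rintro (a | ⟨t, k⟩)
      · exact ⟨Sum.inr (Sum.inl a), rfl⟩
      · by_cases h : t = i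
        · exact ⟨Sum.inl k, by simp [h]⟩
        · exact ⟨Sum.inr (Sum.inr (⟨t, h⟩, k)), rfl⟩

/-- Elimination of all parameters but the input of sample `i`. -/
theorem inv_inputBlock_inv {F : Matrix (ParamIdx Ny Nd ι) (ParamIdx Ny Nd ι) ℝ} (hF : F.PosDef)
    (h0 : ∀ s t, s ≠ t → inputBlock F s t = 0) (i : ι) :
    (inputBlock F⁻¹ i i)⁻¹ = inputBlock F i i -
      (crossBlock F i)ᵀ * thetaBlock (deleteInput F i)⁻¹ * crossBlock F i := by
  have hP : (F.submatrix (splitInput i) (splitInput i)).PosDef :=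
    hF.submatrix (splitInput i).injective
  have h := inv_toBlocks₁₁_inv hP
  rw [inv_submatrix_equiv] at h
  refine h.trans (congrArg (inputBlock F i i - ·) ?_)
  have hsymm (a b : ParamIdx Ny Nd ι) : F a b = F b a := by
    simpa using hF.isHermitian.apply b a
  have h1 (k : Fin Nd) (a : Fin Ny × Fin Nd) :
      (F.submatrix (splitInput i) (splitInput i)).toBlocks₁₂ k (Sum.inl a) =
        crossBlock F i a k := hsymm _ _
  -- Since `d_i` is not coupled to the other inputs, only the `θ`-block of the inverse of the
  -- reduced matrix contributes to the correction.
  have h2 (k : Fin Nd) (t : {t // t ≠ i}) (l : Fin Nd) :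
      (F.submatrix (splitInput i) (splitInput i)).toBlocks₁₂ k (Sum.inr (t, l)) = 0 :=
    congrFun₂ (h0 i t t.2.symm) k l
  have h3 (k : Fin Nd) (a : Fin Ny × Fin Nd) :
      (F.submatrix (splitInput i) (splitInput i)).toBlocks₂₁ (Sum.inl a) k =
        crossBlock F i a k := rfl
  have h4 (k : Fin Nd) (t : {t // t ≠ i}) (l : Fin Nd) :
      (F.submatrix (splitInput i) (splitInput i)).toBlocks₂₁ (Sum.inr (t, l)) k = 0 :=
    congrFun₂ (h0 t i t.2) l k
  have h5 : (F.submatrix (splitInput i) (splitInput i)).toBlocks₂₂ = deleteInput F i := rfl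
  ext k l
  rw [h5]
  simp only [mul_apply, Fintype.sum_sum_type, Fintype.sum_prod_type, h1, h2, h3, h4, zero_mul,
    mul_zero, Finset.sum_const_zero, add_zero, transpose_apply]
  rfl

end Schur

/-! ### Blocks and positive definiteness of the Fisher information -/

section FisherBlocks

variable {Ny Nd : ℕ} {ι : Type*} [DecidableEq ι]
  (Θ : Matrix (Fin Ny) (Fin Nd) ℝ) (D : Matrix (Fin Nd) ι ℝ)

theorem meanDeriv_theta_inl (j : Fin Ny) (k : Fin Nd) (t : ι) (l : Fin Nd) :
    meanDeriv (param Θ D) (Pi.single (Sum.inl (j, k)) 1) (t, Sum.inl l) = 0 := by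
  simp [meanDeriv, inputOf]

theorem meanDeriv_theta_inr (j : Fin Ny) (k : Fin Nd) (t : ι) (i : Fin Ny) :
    meanDeriv (param Θ D) (Pi.single (Sum.inl (j, k)) 1) (t, Sum.inr i) =
      if i = j then D k t else 0 := by
  simp only [meanDeriv, LinearMap.coe_mk, AddHom.coe_mk, Sum.elim_inr, thetaOf_param,
    inputOf_param, Pi.add_apply]
  by_cases h : i = j
  · subst h
    simp [mulVec, dotProduct, thetaOf, inputOf, Pi.single_apply]
  · simp [mulVec, dotProduct, thetaOf, inputOf, Pi.single_apply, h]

theorem meanDeriv_input_inl (s : ι) (k : Fin Nd) (t : ι) (l : Fin Nd) :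
    meanDeriv (param Θ D) (Pi.single (Sum.inr (s, k)) 1) (t, Sum.inl l) =
      if t = s then (if l = k then 1 else 0) else 0 := by
  simp [meanDeriv, inputOf, Pi.single_apply, ite_and]

theorem meanDeriv_input_inr (s : ι) (k : Fin Nd) (t : ι) (i : Fin Ny) :
    meanDeriv (param Θ D) (Pi.single (Sum.inr (s, k)) 1) (t, Sum.inr i) =
      if t = s then Θ i k else 0 := by
  simp only [meanDeriv, LinearMap.coe_mk, AddHom.coe_mk, Sum.elim_inr, thetaOf_param,
    inputOf_param, Pi.add_apply]
  by_cases h : t = s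
  · subst h
    simp [mulVec, dotProduct, thetaOf, inputOf, Pi.single_apply]
  · simp [mulVec, dotProduct, thetaOf, inputOf, h]

theorem regressor_apply (d : Fin Nd → ℝ) (i j : Fin Ny) (k : Fin Nd) :
    regressor Ny d i (j, k) = if i = j then d k else 0 := by
  simp [regressor, one_apply]

variable [Fintype ι]

omit [DecidableEq ι] in
theorem one_kronecker_mul_transpose :
    (1 : Matrix (Fin Ny) (Fin Ny) ℝ) ⊗ₖ (D * Dᵀ) =
      ∑ t, (regressor Ny (D.col t))ᵀ * regressor Ny (D.col t) := by
  ext ⟨j, k⟩ ⟨j', k'⟩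
  rw [Matrix.sum_apply]
  by_cases h : j = j'
  · simp [mul_apply, regressor_apply, h]
  · simp [mul_apply, regressor_apply, h, Ne.symm h]

variable {σe σw : ℝ} (hσe : 0 < σe) (hσw : 0 < σw)
include hσe hσw

theorem fisherInfo_apply_sum (p : ParamIdx Ny Nd ι → ℝ) (a b : ParamIdx Ny Nd ι) :
    fisherInfo σe σw p a b = ∑ t, ((1 / σe ^ 2) *
      (∑ k, meanDeriv p (Pi.single a 1) (t, Sum.inl k) *
        meanDeriv p (Pi.single b 1) (t, Sum.inl k)) + (1 / σw ^ 2) *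
      ∑ j, meanDeriv p (Pi.single a 1) (t, Sum.inr j) *
        meanDeriv p (Pi.single b 1) (t, Sum.inr j)) := by
  rw [fisherInfo_apply hσe hσw, Fintype.sum_prod_type]
  refine Finset.sum_congr rfl fun t _ => ?_
  rw [Fintype.sum_sum_type, Finset.mul_sum, Finset.mul_sum]
  congr 1 <;> refine Finset.sum_congr rfl fun k _ => ?_
  · rw [noiseVar, Sum.elim_inl, Real.coe_toNNReal _ (sq_nonneg _)]
    ring
  · rw [noiseVar, Sum.elim_inr, Real.coe_toNNReal _ (sq_nonneg _)]
    ring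

theorem thetaBlock_fisherInfo :
    thetaBlock (fisherInfo σe σw (param Θ D)) =
      (1 / σw ^ 2) • ((1 : Matrix (Fin Ny) (Fin Ny) ℝ) ⊗ₖ (D * Dᵀ)) := by
  ext ⟨j, k⟩ ⟨j', k'⟩
  simp only [thetaBlock, submatrix_apply, fisherInfo_apply_sum hσe hσw, meanDeriv_theta_inl,
    meanDeriv_theta_inr]
  by_cases h : j = j'
  · subst h
    simp [mul_apply, Finset.mul_sum]
  · simp [h, Ne.symm h]

theorem inputBlock_fisherInfo_self (t : ι) :
    inputBlock (fisherInfo σe σw (param Θ D)) t t =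
      (1 / σe ^ 2) • (1 : Matrix (Fin Nd) (Fin Nd) ℝ) + (1 / σw ^ 2) • (Θᵀ * Θ) := by
  ext k l
  simp only [inputBlock, submatrix_apply, fisherInfo_apply_sum hσe hσw, meanDeriv_input_inl,
    meanDeriv_input_inr]
  rw [Finset.sum_eq_single t (by intro s _ hs; simp [hs]) (by simp)]
  simp [mul_apply, one_apply, eq_comm]

theorem inputBlock_fisherInfo_of_ne {s t : ι} (h : s ≠ t) :
    inputBlock (fisherInfo σe σw (param Θ D)) s t = 0 := by
  ext k l
  simp only [inputBlock, submatrix_apply, fisherInfo_apply_sum hσe hσw, meanDeriv_input_inl,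
    meanDeriv_input_inr]
  refine Finset.sum_eq_zero fun r _ => ?_
  by_cases hr : r = s
  · simp [hr, h]
  · simp [hr]

theorem crossBlock_fisherInfo_apply (t : ι) (j : Fin Ny) (l k : Fin Nd) :
    crossBlock (fisherInfo σe σw (param Θ D)) t (j, l) k = (1 / σw ^ 2) * (Θ j k * D l t) := by
  simp only [crossBlock, submatrix_apply, fisherInfo_apply_sum hσe hσw, meanDeriv_input_inl,
    meanDeriv_input_inr, meanDeriv_theta_inl, meanDeriv_theta_inr]
  rw [Finset.sum_eq_single t (by intro s _ hs; simp [hs]) (by simp)]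
  simp [mul_comm]

theorem transpose_crossBlock_fisherInfo (t : ι) :
    (crossBlock (fisherInfo σe σw (param Θ D)) t)ᵀ =
      (1 / σw ^ 2) • (Θᵀ * regressor Ny (D.col t)) := by
  ext k ⟨j, l⟩
  rw [transpose_apply, crossBlock_fisherInfo_apply Θ D hσe hσw]
  simp [mul_apply, regressor_apply]

theorem fisherInfo_isSymm (p : ParamIdx Ny Nd ι → ℝ) : (fisherInfo σe σw p).IsSymm := by
  ext a b
  simp only [transpose_apply, fisherInfo_apply_sum hσe hσw, mul_comm]

/-- By `F = Jᵀ V⁻¹ J` with `V` positive, it is enough that `J` is injective. In its kernel the input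
perturbations vanish because each `d_t` is observed directly; the perturbation of `Θ` then
annihilates `D`, hence `D * Dᵀ`, and is zero. -/
theorem fisherInfo_posDef (hD : IsUnit (D * Dᵀ)) :
    (fisherInfo σe σw (param Θ D)).PosDef := by
  have hv (c : ObsIdx Ny Nd ι) : (0 : ℝ) < noiseVar Ny Nd ι σe σw c := by
    exact_mod_cast pos_iff_ne_zero.mpr (noiseVar_ne_zero hσe hσw c)
  have hF : fisherInfo σe σw (param Θ D) = (LinearMap.toMatrix' (meanDeriv (param Θ D)))ᴴ *
      diagonal (fun c => (noiseVar Ny Nd ι σe σw c : ℝ)⁻¹) *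
        LinearMap.toMatrix' (meanDeriv (param Θ D)) := by
    ext a b
    rw [fisherInfo_apply hσe hσw, mul_apply]
    refine Finset.sum_congr rfl fun c _ => ?_
    rw [mul_diagonal]
    simp only [conjTranspose_apply, star_trivial, LinearMap.toMatrix'_apply]
    ring
  rw [hF]
  refine (PosDef.diagonal fun c => inv_pos.mpr (hv c)).conjTranspose_mul_mul_same ?_
  intro q r hqr
  rw [LinearMap.toMatrix'_mulVec, LinearMap.toMatrix'_mulVec, ← sub_eq_zero, ← map_sub] at hqr
  rw [← sub_eq_zero]
  set w := q - r
  have hin (t : ι) : inputOf w t = 0 := by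
    ext k
    exact congrFun hqr (t, Sum.inl k)
  have hth : thetaOf w * D = 0 := by
    ext j t
    have : (thetaOf w *ᵥ D.col t) j = 0 := by
      simpa [meanDeriv, hin, inputOf_param] using congrFun hqr (t, Sum.inr j)
    exact this
  have hth0 : thetaOf w = 0 := by
    have h := congrArg (· * Dᵀ) hth
    simp only [Matrix.mul_assoc, Matrix.zero_mul] at h
    have hdet := (isUnit_iff_isUnit_det _).mp hD
    rw [← Matrix.mul_one (thetaOf w), ← mul_nonsing_inv _ hdet, ← Matrix.mul_assoc, h,
      Matrix.zero_mul]
  ext (⟨j, k⟩ | ⟨t, k⟩)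
  · exact congrFun₂ hth0 j k
  · exact congrFun (hin t) k

end FisherBlocks

/-! ### Closed forms of the bounds -/

section BoundMatrices

variable {Ny Nd : ℕ} {ι : Type*} [Fintype ι] [DecidableEq ι]
  (Θ : Matrix (Fin Ny) (Fin Nd) ℝ) (D : Matrix (Fin Nd) ι ℝ)

theorem sum_erase_eq_sum_ne {M : Type*} [AddCommMonoid M] (i : ι) (f : ι → M) :
    ∑ t ∈ Finset.univ.erase i, f t = ∑ t : {t // t ≠ i}, f t :=
  Finset.sum_subtype _ (by simp) f

/-- Erasing `i` drops only its correction; sample `i` still contributes to `D * Dᵀ`, and that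
contribution is the extra term. -/
theorem schurTheta_erase (σe σw : ℝ) (i : ι) :
    schurTheta σe σw Θ D (Finset.univ.erase i) =
      schurTheta σe σw Θ (D.submatrix id (Subtype.val : {t // t ≠ i} → ι)) Finset.univ +
        (regressor Ny (D.col i))ᵀ * regressor Ny (D.col i) := by
  rw [schurTheta, schurTheta, one_kronecker_mul_transpose, one_kronecker_mul_transpose,
    sum_erase_eq_sum_ne,
    ← Finset.sum_erase_add _ _ (Finset.mem_univ i), sum_erase_eq_sum_ne]
  exact add_sub_right_comm _ _ _

variable {σe σw : ℝ} (hσe : 0 < σe) (hσw : 0 < σw)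
include hσe hσw

theorem cross_correction (t : ι) :
    crossBlock (fisherInfo σe σw (param Θ D)) t *
      ((1 / σe ^ 2) • (1 : Matrix (Fin Nd) (Fin Nd) ℝ) + (1 / σw ^ 2) • (Θᵀ * Θ))⁻¹ *
      (crossBlock (fisherInfo σe σw (param Θ D)) t)ᵀ =
    (1 / σw ^ 2) • (σe ^ 2 •
      ((regressor Ny (D.col t))ᵀ * sigmaTheta σe σw Θ * regressor Ny (D.col t))) := by
  have hM : (1 / σe ^ 2) • (1 : Matrix (Fin Nd) (Fin Nd) ℝ) + (1 / σw ^ 2) • (Θᵀ * Θ) =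
      (σe ^ 2 * σw ^ 2)⁻¹ • (σw ^ 2 • (1 : Matrix (Fin Nd) (Fin Nd) ℝ) + σe ^ 2 • (Θᵀ * Θ)) := by
    rw [smul_add, smul_smul, smul_smul]
    congr 2 <;> field_simp
  have hB : crossBlock (fisherInfo σe σw (param Θ D)) t =
      (1 / σw ^ 2) • ((regressor Ny (D.col t))ᵀ * Θ) := by
    rw [← transpose_transpose (crossBlock _ t), transpose_crossBlock_fisherInfo Θ D hσe hσw]
    simp
  rw [transpose_crossBlock_fisherInfo Θ D hσe hσw, hB, hM, inv_smul_real (by positivity), inv_inv,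
    sigmaTheta]
  simp only [Matrix.smul_mul, Matrix.mul_smul, smul_smul, Matrix.mul_assoc]
  congr 1
  field_simp

variable {D} (hD : IsUnit (D * Dᵀ))
include hD

theorem inv_thetaBlock_inv_fisherInfo :
    (thetaBlock (fisherInfo σe σw (param Θ D))⁻¹)⁻¹ =
      (1 / σw ^ 2) • schurTheta σe σw Θ D Finset.univ := by
  rw [inv_thetaBlock_inv (fisherInfo_posDef Θ D hσe hσw hD)
    (inputBlock_fisherInfo_self Θ D hσe hσw)
    (fun s t => inputBlock_fisherInfo_of_ne Θ D hσe hσw),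
    thetaBlock_fisherInfo Θ D hσe hσw]
  simp only [cross_correction Θ D hσe hσw]
  rw [schurTheta, smul_sub, Finset.smul_sum, Finset.smul_sum]

/-- Deleting `d_i` amounts to treating it as known: the `θ`-block of `F` keeps all samples, while
elimination runs only over the remaining inputs. -/
theorem inv_thetaBlock_inv_deleteInput (i : ι) :
    (thetaBlock (deleteInput (fisherInfo σe σw (param Θ D)) i)⁻¹)⁻¹ =
      (1 / σw ^ 2) • schurTheta σe σw Θ D (Finset.univ.erase i) := by
  have h1 (t : {t // t ≠ i}) : inputBlock (deleteInput (fisherInfo σe σw (param Θ D)) i) t t =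
      (1 / σe ^ 2) • (1 : Matrix (Fin Nd) (Fin Nd) ℝ) + (1 / σw ^ 2) • (Θᵀ * Θ) :=
    inputBlock_fisherInfo_self Θ D hσe hσw t
  have h2 (s t : {t // t ≠ i}) (h : s ≠ t) :
      inputBlock (deleteInput (fisherInfo σe σw (param Θ D)) i) s t = 0 :=
    inputBlock_fisherInfo_of_ne Θ D hσe hσw (Subtype.val_injective.ne h)
  have h3 (t : {t // t ≠ i}) : crossBlock (deleteInput (fisherInfo σe σw (param Θ D)) i) t =
      crossBlock (fisherInfo σe σw (param Θ D)) t := rfl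
  have h4 : thetaBlock (deleteInput (fisherInfo σe σw (param Θ D)) i) =
      thetaBlock (fisherInfo σe σw (param Θ D)) := rfl
  rw [inv_thetaBlock_inv (deleteInput_posDef (fisherInfo_posDef Θ D hσe hσw hD) i) h1 h2, h4,
    thetaBlock_fisherInfo Θ D hσe hσw]
  simp only [h3, cross_correction Θ D hσe hσw]
  rw [schurTheta, smul_sub, Finset.smul_sum, Finset.smul_sum]
  rw [sum_erase_eq_sum_ne]

/-- No direct estimate is needed: up to the factor `σw ^ 2` this is the inverse of a principal block
of the positive definite `F⁻¹`. -/
theorem schurTheta_posDef : (schurTheta σe σw Θ D Finset.univ).PosDef := by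
  have h := (thetaBlock_inv_posDef (fisherInfo_posDef Θ D hσe hσw hD)).inv
  rw [inv_thetaBlock_inv_fisherInfo Θ hσe hσw hD] at h
  have h2 := h.smul (show 0 < σw ^ 2 by positivity)
  rwa [smul_smul, mul_one_div_cancel (by positivity), one_smul] at h2

theorem thetaBlock_inv_fisherInfo :
    thetaBlock (fisherInfo σe σw (param Θ D))⁻¹ =
      σw ^ 2 • (schurTheta σe σw Θ D Finset.univ)⁻¹ := by
  have hu := (isUnit_iff_isUnit_det _).mp
    (thetaBlock_inv_posDef (fisherInfo_posDef Θ D hσe hσw hD)).isUnit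
  rw [← nonsing_inv_nonsing_inv _ hu, inv_thetaBlock_inv_fisherInfo Θ hσe hσw hD,
    inv_smul_real (by positivity), one_div, inv_inv]

theorem schurTheta_erase_posDef (i : ι) :
    (schurTheta σe σw Θ D (Finset.univ.erase i)).PosDef := by
  have h := (thetaBlock_inv_posDef
    (deleteInput_posDef (fisherInfo_posDef Θ D hσe hσw hD) i)).inv
  rw [inv_thetaBlock_inv_deleteInput Θ hσe hσw hD] at h
  have h2 := h.smul (show 0 < σw ^ 2 by positivity)
  rwa [smul_smul, mul_one_div_cancel (by positivity), one_smul] at h2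

theorem cWithout_eq_thetaBlock (i : ι) :
    cWithout σe σw Θ D i =
      thetaBlock (deleteInput (fisherInfo σe σw (param Θ D)) i)⁻¹ := by
  have hu := (isUnit_iff_isUnit_det _).mp (thetaBlock_inv_posDef
    (deleteInput_posDef (fisherInfo_posDef Θ D hσe hσw hD) i)).isUnit
  rw [← nonsing_inv_nonsing_inv _ hu, inv_thetaBlock_inv_deleteInput Θ hσe hσw hD,
    inv_smul_real (by positivity), one_div, inv_inv, cWithout]

/-- Both Schur matrices are positive definite, the reduced one by `hD'`, so the double inverses
cancel and `schurTheta_erase` remains. -/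
theorem inv_cWithout (i : ι)
    (hD' : IsUnit (D.submatrix id (Subtype.val : {t // t ≠ i} → ι) *
      (D.submatrix id (Subtype.val : {t // t ≠ i} → ι))ᵀ)) :
    (cWithout σe σw Θ D i)⁻¹ =
      (σw ^ 2 • (schurTheta σe σw Θ (D.submatrix id (Subtype.val : {t // t ≠ i} → ι))
        Finset.univ)⁻¹)⁻¹ +
        (1 / σw ^ 2) • ((regressor Ny (D.col i))ᵀ * regressor Ny (D.col i)) := by
  have h1 := (isUnit_iff_isUnit_det _).mp (schurTheta_erase_posDef Θ hσe hσw hD i).isUnit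
  have h2 := (isUnit_iff_isUnit_det _).mp (schurTheta_posDef Θ hσe hσw hD').isUnit
  rw [cWithout, inv_smul_real (by positivity), inv_smul_real (by positivity),
    nonsing_inv_nonsing_inv _ h1, nonsing_inv_nonsing_inv _ h2, schurTheta_erase, smul_add, one_div]

theorem inv_inputBlock_inv_fisherInfo (i : ι) :
    (inputBlock (fisherInfo σe σw (param Θ D))⁻¹ i i)⁻¹ =
      (1 / σe ^ 2) • schurInput σe σw Θ D i := by
  rw [inv_inputBlock_inv (fisherInfo_posDef Θ D hσe hσw hD)
    (fun s t => inputBlock_fisherInfo_of_ne Θ D hσe hσw),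
    ← cWithout_eq_thetaBlock Θ hσe hσw hD, inputBlock_fisherInfo_self Θ D hσe hσw]
  have hB : crossBlock (fisherInfo σe σw (param Θ D)) i =
      (1 / σw ^ 2) • ((regressor Ny (D.col i))ᵀ * Θ) := by
    rw [← transpose_transpose (crossBlock _ i), transpose_crossBlock_fisherInfo Θ D hσe hσw]
    simp
  rw [transpose_crossBlock_fisherInfo Θ D hσe hσw, hB, schurInput]
  simp only [Matrix.smul_mul, Matrix.mul_smul, smul_smul, Matrix.mul_assoc, smul_sub, smul_add]
  have h1 : 1 / σe ^ 2 * (σe ^ 2 / σw ^ 2) = 1 / σw ^ 2 := by field_simp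
  have h2 : 1 / σe ^ 2 * (σe ^ 2 / σw ^ 4) = 1 / σw ^ 2 * (1 / σw ^ 2) := by field_simp
  rw [h1, h2]

theorem inputBlock_inv_posDef (i : ι) :
    (inputBlock (fisherInfo σe σw (param Θ D))⁻¹ i i).PosDef :=
  (fisherInfo_posDef Θ D hσe hσw hD).inv.submatrix fun k l h => by simpa using h

theorem schurInput_posDef (i : ι) : (schurInput σe σw Θ D i).PosDef := by
  have h := (inputBlock_inv_posDef Θ hσe hσw hD i).inv
  rw [inv_inputBlock_inv_fisherInfo Θ hσe hσw hD] at h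
  have h2 := h.smul (show 0 < σe ^ 2 by positivity)
  rwa [smul_smul, mul_one_div_cancel (by positivity), one_smul] at h2

theorem inputBlock_inv_fisherInfo (i : ι) :
    inputBlock (fisherInfo σe σw (param Θ D))⁻¹ i i =
      σe ^ 2 • (schurInput σe σw Θ D i)⁻¹ := by
  have hu := (isUnit_iff_isUnit_det _).mp (inputBlock_inv_posDef Θ hσe hσw hD i).isUnit
  rw [← nonsing_inv_nonsing_inv _ hu, inv_inputBlock_inv_fisherInfo Θ hσe hσw hD,
    inv_smul_real (by positivity), one_div, inv_inv]

/-- The Cramér–Rao bound for a subvector of the parameters. -/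
theorem posSemidef_covMat_sub_inv_fisherInfo {κ : Type*} [Fintype κ] (e : κ → ParamIdx Ny Nd ι)
    {T : Obs Ny Nd ι → κ → ℝ}
    (hT : IsLocallyUnbiased (obsLaw σe σw) (fun p a => p (e a)) (param Θ D) T) :
    (covMat (obsLaw σe σw (param Θ D)) T -
      (fisherInfo σe σw (param Θ D))⁻¹.submatrix e e).PosSemidef := by
  refine posSemidef_covMat_sub (memLp_score hσe hσw _) (integral_score hσe hσw _)
    (fun _ _ => rfl) (fisherInfo_posDef Θ D hσe hσw hD) e hT.memLp fun a b => ?_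
  have h1 := hasDerivAt_integral_obsLaw hσe hσw (param Θ D) b (hT.memLp a)
  have hline : HasDerivAt (fun h : ℝ => param Θ D + h • Pi.single b (1 : ℝ)) (Pi.single b 1) 0 := by
    simpa using ((hasDerivAt_id (0 : ℝ)).smul_const (Pi.single b (1 : ℝ))).const_add (param Θ D)
  have h2 := (show HasFDerivAt _ (0 : (ParamIdx Ny Nd ι → ℝ) →L[ℝ] ℝ)
    (param Θ D + (0 : ℝ) • Pi.single b 1) by
      simpa using hT.gradient_bias_eq_zero a).comp_hasDerivAt (0 : ℝ) hline
  have h3 := (hasDerivAt_pi.mp hline) (e a)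
  -- Two values of the derivative of the bias along the coordinate `b`: `E[T S_b]` minus the
  -- derivative of the estimated coordinate, and zero by local unbiasedness.
  have h4 := (h1.sub h3).unique h2
  simpa [sub_eq_zero] using h4

end BoundMatrices

end CCRB

theorem mainTheorem2 {Ny Nd : ℕ} {ι : Type*} [Fintype ι] [DecidableEq ι]
    (σe σw : ℝ) (hσe : 0 < σe) (hσw : 0 < σw)
    (Θ : Matrix (Fin Ny) (Fin Nd) ℝ) (D : Matrix (Fin Nd) ι ℝ)
    (F : Matrix (CCRB.ParamIdx Ny Nd ι) (CCRB.ParamIdx Ny Nd ι) ℝ)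
    (hF : F = CCRB.fisherInfo σe σw (CCRB.param Θ D)) :
    -- the Fisher information is well defined: density, differentiability, square-integrable score
    ((∀ p : CCRB.ParamIdx Ny Nd ι → ℝ, CCRB.obsLaw σe σw p =
        volume.withDensity fun z => ENNReal.ofReal (CCRB.likelihood σe σw p z)) ∧
      (∀ z, DifferentiableAt ℝ (fun q => Real.log (CCRB.likelihood σe σw q z))
        (CCRB.param Θ D)) ∧
      (∀ a, MemLp (CCRB.score σe σw (CCRB.param Θ D) a) 2
        (CCRB.obsLaw σe σw (CCRB.param Θ D)))) ∧
    -- block form of the Fisher information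
    (F.IsSymm ∧
      CCRB.thetaBlock F = (1 / σw ^ 2) •
        ∑ t, (CCRB.regressor Ny (D.col t))ᵀ * CCRB.regressor Ny (D.col t) ∧
      CCRB.thetaBlock F = (1 / σw ^ 2) • ((1 : Matrix (Fin Ny) (Fin Ny) ℝ) ⊗ₖ (D * Dᵀ)) ∧
      (∀ t, CCRB.inputBlock F t t =
        (1 / σe ^ 2) • (1 : Matrix (Fin Nd) (Fin Nd) ℝ) + (1 / σw ^ 2) • (Θᵀ * Θ)) ∧
      (∀ s t, s ≠ t → CCRB.inputBlock F s t = 0) ∧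
      (∀ t, (CCRB.crossBlock F t)ᵀ = (1 / σw ^ 2) • (Θᵀ * CCRB.regressor Ny (D.col t))) ∧
      (∀ t k j l, (CCRB.crossBlock F t)ᵀ k (j, l) = (1 / σw ^ 2) * (Θ j k * D l t))) ∧
    -- the bounds, when the inputs span the input space
    (IsUnit (D * Dᵀ) →
      F.PosDef ∧
      -- the bound for `θ`
      ((CCRB.schurTheta σe σw Θ D Finset.univ).PosDef ∧
        CCRB.thetaBlock F⁻¹ = σw ^ 2 • (CCRB.schurTheta σe σw Θ D Finset.univ)⁻¹ ∧
        ∀ T : CCRB.Obs Ny Nd ι → Fin Ny × Fin Nd → ℝ,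
          CCRB.IsLocallyUnbiased (CCRB.obsLaw σe σw) (fun p => vec (CCRB.thetaOf p)ᵀ)
            (CCRB.param Θ D) T →
          (CCRB.covMat (CCRB.obsLaw σe σw (CCRB.param Θ D)) T -
            σw ^ 2 • (CCRB.schurTheta σe σw Θ D Finset.univ)⁻¹).PosSemidef) ∧
      -- the bound for `d_i`
      (∀ i,
        (CCRB.schurTheta σe σw Θ D (Finset.univ.erase i)).PosDef ∧
        CCRB.cWithout σe σw Θ D i = CCRB.thetaBlock (CCRB.deleteInput F i)⁻¹ ∧
        (∀ D' : Matrix (Fin Nd) {t // t ≠ i} ℝ, D' = D.submatrix id Subtype.val →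
          IsUnit (D' * D'ᵀ) →
          (CCRB.cWithout σe σw Θ D i)⁻¹ =
            (σw ^ 2 • (CCRB.schurTheta σe σw Θ D' Finset.univ)⁻¹)⁻¹ +
              (1 / σw ^ 2) • ((CCRB.regressor Ny (D.col i))ᵀ * CCRB.regressor Ny (D.col i))) ∧
        (CCRB.schurInput σe σw Θ D i).PosDef ∧
        CCRB.inputBlock F⁻¹ i i = σe ^ 2 • (CCRB.schurInput σe σw Θ D i)⁻¹ ∧
        ∀ T : CCRB.Obs Ny Nd ι → Fin Nd → ℝ,
          CCRB.IsLocallyUnbiased (CCRB.obsLaw σe σw) (fun p => CCRB.inputOf p i)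
            (CCRB.param Θ D) T →
          (CCRB.covMat (CCRB.obsLaw σe σw (CCRB.param Θ D)) T -
            σe ^ 2 • (CCRB.schurInput σe σw Θ D i)⁻¹).PosSemidef)) := by
  subst hF
  refine ⟨⟨CCRB.obsLaw_eq_withDensity hσe hσw,
      CCRB.differentiableAt_log_likelihood hσe hσw _, CCRB.memLp_score hσe hσw _⟩,
    ⟨CCRB.fisherInfo_isSymm hσe hσw _, ?_, CCRB.thetaBlock_fisherInfo Θ D hσe hσw,
      CCRB.inputBlock_fisherInfo_self Θ D hσe hσw,
      fun s t => CCRB.inputBlock_fisherInfo_of_ne Θ D hσe hσw,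
      CCRB.transpose_crossBlock_fisherInfo Θ D hσe hσw,
      fun t k j l => CCRB.crossBlock_fisherInfo_apply Θ D hσe hσw t j l k⟩, fun hD => ?_⟩
  · rw [CCRB.thetaBlock_fisherInfo Θ D hσe hσw, CCRB.one_kronecker_mul_transpose]
  refine ⟨CCRB.fisherInfo_posDef Θ D hσe hσw hD, ⟨CCRB.schurTheta_posDef Θ hσe hσw hD,
    CCRB.thetaBlock_inv_fisherInfo Θ hσe hσw hD, fun T hT => ?_⟩, fun i =>
    ⟨CCRB.schurTheta_erase_posDef Θ hσe hσw hD i, CCRB.cWithout_eq_thetaBlock Θ hσe hσw hD i,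
      ?_, CCRB.schurInput_posDef Θ hσe hσw hD i, CCRB.inputBlock_inv_fisherInfo Θ hσe hσw hD i,
      fun T hT => ?_⟩⟩
  · rw [← CCRB.thetaBlock_inv_fisherInfo Θ hσe hσw hD]
    -- The estimand `vec (thetaOf p)ᵀ` is `p ∘ Sum.inl` by definition, so `hT` applies unchanged.
    exact CCRB.posSemidef_covMat_sub_inv_fisherInfo Θ hσe hσw hD Sum.inl hT
  · rintro D' rfl hD'
    exact CCRB.inv_cWithout Θ hσe hσw hD i hD'
  · rw [← CCRB.inputBlock_inv_fisherInfo Θ hσe hσw hD]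
    exact CCRB.posSemidef_covMat_sub_inv_fisherInfo Θ hσe hσw hD (fun k => Sum.inr (i, k)) hT
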